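/- Let $n,k,N\in\mathbb{N}_0$, let $\Omega\subseteq[-\infty,\infty]^n$ be a sample space (for instance a subset of $\mathbb{R}^n$), suppose that its finite part $\Omega\cap\mathbb{R}^n$ is convex, and let $\phi:\Omega\cap\mathbb{R}^n\to\mathbb{R}$ be continuously differentiable and strictly convex. The associated Bregman divergence is $\ell_\phi(u,v)=\phi(u)-\phi(v)-\langle u-v,\nabla\phi(v)\rangle$ for $u,v\in\Omega\cap\mathbb{R}^n$, with the convention $\ell_\phi(u,v)=+\infty$ if $u\in\Omega$ has an infinite coordinate. Let $Y$ take values in a set $\mathcal{Y}$, let $P_{Y|X}$ be a fixed conditional distribution of $Y$ given $X\in\Omega$, and for a prior $P_X$ on $\Omega$ let $$R_\phi(P_X,P_{Y|X})=\inf_{f}\mathbb{E}\bigl[\ell_\phi(X,f(Y))\bigr]\in[0,\infty],$$ where the infimum is over all measurable $f:\mathcal{Y}\to\Omega\cap\mathbb{R}^n$. Given measurable functions $f_1,\dots,f_k:\Omega\to[-\infty,\infty]$ and $c_1,\dots,c_k\in\mathbb{R}$, let $\mathcal{H}_k$ be the set of all regular Borel probability measures $P$ on $\Omega$ for which each $f_i$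 is $P$-integrable with $\mathbb{E}_P[f_i(X)]\le c_i$; it is given the topology of weak convergence and is assumed to be non-empty. Assume that (i) $\mathcal{H}_k$ is compact; (ii) $P_X\mapsto R_\phi(P_X,P_{Y|X})$ is upper semicontinuous on $\mathcal{H}_k$; (iii) $\mathcal{Y}$ is finite with $|\mathcal{Y}|\le N$; (iv) for every $y\in\mathcal{Y}$, $x\mapsto P_{Y|X}(y|x)$ is continuous on the interior of $\Omega$. Then there exists $P_X^\star\in\mathcal{H}_k$ such that 1. $P_X^\star$ is least favorable: $R_\phi(P_X^\star,P_{Y|X})=\max_{P_X\in\mathcal{H}_k}R_\phi(P_X,P_{Y|X})$; 2. $P_X^\star$ is discrete with at most $N(k+1)(n+1)$ mass points (which are points of $\Omega$, so individual coordinates may be $\pm\infty$ if $\Omega$ contains such points); 3. $P_X^\star$ is discrete with at most $N(k+1)$ mass points if in addition T-compatibility holds, that is, if there is an operator $T$, with values in $\mathbb{R}^n$, such that for every $P_X\in\mathcal{H}_k$ under which $X$ has a finite mean, $\mathbb{E}_{P_X}[X|Y]=T(Y;P_Y)$ almost surely, where $P_Y$ is the marginal distribution of $Y$ induced by $P_X$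 and $P_{Y|X}$. -/

import Mathlib

open MeasureTheory ProbabilityTheory
open scoped ENNReal

namespace BregmanPrior

noncomputable section

/-- A point of `[-∞, ∞]ⁿ` all of whose coordinates are finite. -/
def IsFinitePoint {n : ℕ} (x : Fin n → EReal) : Prop := ∀ i, x i ≠ ⊥ ∧ x i ≠ ⊤

/-- The vector of `ℝⁿ` that corresponds to a finite point of `[-∞, ∞]ⁿ`
(infinite coordinates are sent to `0`; this is used for finite points only). -/
def toVec {n : ℕ} (x : Fin n → EReal) : EuclideanSpace ℝ (Fin n) :=
  WithLp.toLp 2 fun i => (x i).toReal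

/-- The finite part `Ω ∩ ℝⁿ` of a sample space `Ω ⊆ [-∞, ∞]ⁿ`. -/
def finitePart {n : ℕ} (Ω : Set (Fin n → EReal)) : Set (EuclideanSpace ℝ (Fin n)) :=
  {u | (fun i => ((u i : ℝ) : EReal)) ∈ Ω}

/-- The Bregman divergence `φ u - φ v - ⟨u - v, ∇φ v⟩` of a function `φ` on `D ⊆ ℝⁿ`. The gradient
is taken within `D`; for convex `D` and `u, v ∈ D` the inner product does not depend on the choice
of a gradient, even when `D` has empty interior. -/
def bregman {n : ℕ} (D : Set (EuclideanSpace ℝ (Fin n))) (φ : EuclideanSpace ℝ (Fin n) → ℝ)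
    (u v : EuclideanSpace ℝ (Fin n)) : ℝ :=
  φ u - φ v - inner ℝ (u - v) (gradientWithin φ D v)

open Classical in
/-- The loss `ℓ_φ(x, v)` for a parameter `x ∈ Ω` and an estimate `v ∈ Ω ∩ ℝⁿ`: the Bregman
divergence at finite `x`, and `∞` if a coordinate of `x` is infinite (the divergence of a strictly
convex function tends to infinity there). -/
def loss {n : ℕ} (Ω : Set (Fin n → EReal)) (φ : EuclideanSpace ℝ (Fin n) → ℝ)
    (x : Fin n → EReal) (v : EuclideanSpace ℝ (Fin n)) : ℝ≥0∞ :=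
  if IsFinitePoint x then ENNReal.ofReal (bregman (finitePart Ω) φ (toVec x) v) else ⊤

/-- The Bayes risk `R_φ(P_X, P_{Y|X}) = inf_f E[ℓ_φ(X, f(Y))]`, the infimum being over all
measurable estimators `f : 𝒴 → Ω ∩ ℝⁿ`. Here `κ` is `P_{Y|X}` and `P` is `P_X`. -/
def bregmanRisk {n : ℕ} {Ω : Set (Fin n → EReal)} {𝒴 : Type*} [MeasurableSpace 𝒴]
    (φ : EuclideanSpace ℝ (Fin n) → ℝ) (κ : Kernel Ω 𝒴) (P : ProbabilityMeasure Ω) : ℝ≥0∞ :=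
  ⨅ f : {f : 𝒴 → finitePart Ω // Measurable f},
    ∫⁻ x, ∫⁻ y, loss Ω φ x.1 (f.1 y).1 ∂(κ x) ∂(P : Measure Ω)

/-- The moment set: all regular probability measures `P` on `Ω` for which each `f i` is
`P`-integrable with `E_P[f i] ≤ c i`. -/
def momentSet {n k : ℕ} {Ω : Set (Fin n → EReal)} (f : Fin k → Ω → EReal) (c : Fin k → ℝ) :
    Set (ProbabilityMeasure Ω) :=
  {P | (P : Measure Ω).Regular ∧ ∀ i,
    (∀ᵐ x ∂(P : Measure Ω), f i x ≠ ⊥ ∧ f i x ≠ ⊤) ∧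
    Integrable (fun x => (f i x).toReal) (P : Measure Ω) ∧
    ∫ x, (f i x).toReal ∂(P : Measure Ω) ≤ c i}

/-- `X` is almost surely finite and has a finite mean under `P`. -/
def HasFiniteMean {n : ℕ} {Ω : Set (Fin n → EReal)} (P : ProbabilityMeasure Ω) : Prop :=
  (∀ᵐ x ∂(P : Measure Ω), IsFinitePoint x.1) ∧
    Integrable (fun x : Ω => toVec x.1) (P : Measure Ω)

/-- T-compatibility with respect to `κ` and `F`: there is an operator `T` such that
`E_P[X | Y] = T(Y; P_Y)` almost surely for every prior `P ∈ F` (for which the conditional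
expectation makes sense). The pair `(X, Y)` is realised on `Ω × 𝒴` under `P_X ⊗ P_{Y|X}`, and
`κ ∘ₘ P` is the marginal of `Y`. -/
def TCompatible {n : ℕ} {Ω : Set (Fin n → EReal)} {𝒴 : Type*} [MeasurableSpace 𝒴]
    (κ : Kernel Ω 𝒴) (F : Set (ProbabilityMeasure Ω)) : Prop :=
  ∃ T : 𝒴 → Measure 𝒴 → EuclideanSpace ℝ (Fin n), ∀ P ∈ F, HasFiniteMean P →
    ((P : Measure Ω) ⊗ₘ κ)[fun z : Ω × 𝒴 => toVec z.1.1 |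
        MeasurableSpace.comap (Prod.snd : Ω × 𝒴 → 𝒴) inferInstance]
      =ᵐ[(P : Measure Ω) ⊗ₘ κ] fun z => T z.2 (κ ∘ₘ (P : Measure Ω))

/-- `P` is discrete with at most `d` mass points. -/
def HasAtMostMassPoints {n : ℕ} {Ω : Set (Fin n → EReal)} (P : ProbabilityMeasure Ω) (d : ℕ) :
    Prop :=
  ∃ S : Finset Ω, S.card ≤ d ∧ (P : Measure Ω) (S : Set Ω)ᶜ = 0

end

end BregmanPrior

open BregmanPrior

/-! Compactness and upper semicontinuity give a maximizer `P`; it remains to discretize it without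
lowering the risk. For a fixed estimator the expected loss is `E[φ(X)]` minus a linear expression in
the numbers `P(Y = y)` and vectors `E[X; Y = y]` (`lintegral_lintegral_loss`). Hence a prior with
the same values of these moments and a mean of `φ` at least as large has at least the same risk
(`bregmanRisk_le_of_moments`). Keeping also the `k` means of the `f i` leaves `|𝒴| + k + |𝒴| n`
linear constraints. Under T-compatibility the law of `Y` already fixes the conditional means, so
`|𝒴| + k` constraints suffice.

The discretization `exists_weights_moments` is of Carathéodory type: the mean of an integrable
finite-dimensional vector is a finite convex combination of its values on a set of full measure, and
surplus atoms are removed by moving along the kernel of the constraints in a direction that does not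
decrease the mean of `φ`.

The delicate point is that a finite risk must make `X` and `φ(X)` integrable
(`integrable_of_bregmanRisk_lt_top`). Here upper semicontinuity is applied along mixtures of `P`
with a discrete prior `Q`, as the weight of `P` tends to zero. Nearly optimal estimators for the
mixture have finite loss under `P`, yet their value at `y` has small divergence from the conditional
mean `m` under `Q`. The atoms of `Q` are chosen so that `m` is a relative interior point, where
strict convexity makes the divergence grow at least linearly and so dominate `‖x - m‖`.

If the maximal risk is infinite, the same mixtures show that it is infinite at every prior of the
moment set, so any discrete member will do. -/

namespace BregmanPrior

open scoped NNReal Topology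

/-! ### Separation from convex cones that need not be closed -/

section Cone

variable {E : Type*} [NormedAddCommGroup E] [NormedSpace ℝ E] [FiniteDimensional ℝ E]

/-- In a finite-dimensional space a point outside a spanning convex cone can be separated from it,
even if the cone is not closed. -/
theorem exists_nonpos_functional_of_notMem_cone {K : Set E} (hK : Submodule.span ℝ K = ⊤) {z : E}
    (hz : z ∉ Submodule.span ℝ≥0 K) :
    ∃ F : E →L[ℝ] ℝ, F ≠ 0 ∧ ∀ x ∈ K, F x ≤ 0 := by
  set C : Set E := (Submodule.span ℝ≥0 K : Set E) with hC
  have hconv : Convex ℝ C := by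
    intro x hx y hy a b ha hb _
    exact add_mem (Submodule.smul_mem (Submodule.span ℝ≥0 K) ⟨a, ha⟩ hx)
      (Submodule.smul_mem (Submodule.span ℝ≥0 K) ⟨b, hb⟩ hy)
  have h0 : (0 : E) ∈ C := zero_mem _
  have hKC : K ⊆ C := Submodule.subset_span
  have haff : affineSpan ℝ C = ⊤ := by
    rw [AffineSubspace.affineSpan_eq_top_iff_vectorSpan_eq_top_of_nonempty ℝ E E ⟨0, h0⟩,
      eq_top_iff, ← hK, Submodule.span_le]
    intro x hx
    simpa using vsub_mem_vectorSpan ℝ (hKC hx) h0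
  -- The cone contains `0` and spans, so it has interior points; separating `z` from the open
  -- interior avoids any closedness assumption.
  have hint : (interior C).Nonempty := hconv.interior_nonempty_iff_affineSpan_eq_top.2 haff
  obtain ⟨F, hF⟩ := geometric_hahn_banach_open_point hconv.interior isOpen_interior
    (fun h => hz (interior_subset h))
  have hcl : ∀ x ∈ C, F x ≤ F z := by
    intro x hx
    have hx' : x ∈ closure (interior C) := by
      rw [hconv.closure_interior_eq_closure_of_nonempty_interior hint]
      exact subset_closure hx
    have hsub : interior C ⊆ {x | F x ≤ F z} := fun y hy => (hF y hy).le
    exact closure_minimal hsub (isClosed_le F.continuous continuous_const) hx'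
  refine ⟨F, ?_, ?_⟩
  · rintro rfl
    obtain ⟨y, hy⟩ := hint
    simpa using hF y hy
  · intro x hx
    -- A functional bounded above on a cone is nonpositive there: the chosen multiple of `x` would
    -- have value `|F z| + 1 > F z`.
    by_contra! hpos
    have hmem : ((Real.toNNReal ((|F z| + 1) / F x)) : ℝ≥0) • x ∈ C :=
      Submodule.smul_mem _ _ (hKC hx)
    have h1 := hcl _ hmem
    rw [NNReal.smul_def, map_smul, Real.coe_toNNReal _ (by positivity), smul_eq_mul,
      div_mul_cancel₀ _ hpos.ne'] at h1
    have := le_abs_self (F z)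
    linarith

/-- The relative version of `exists_nonpos_functional_of_notMem_cone`. -/
theorem exists_nonpos_functional_of_mem_span {K : Set E} {z : E} (hzK : z ∈ Submodule.span ℝ K)
    (hz : z ∉ Submodule.span ℝ≥0 K) :
    ∃ F : E →L[ℝ] ℝ, (∃ x ∈ K, F x ≠ 0) ∧ ∀ x ∈ K, F x ≤ 0 := by
  set W := Submodule.span ℝ K with hW
  let K' : Set W := ((↑) : W → E) ⁻¹' K
  have hK' : Submodule.span ℝ K' = ⊤ := Submodule.span_span_coe_preimage
  have hz' : (⟨z, hzK⟩ : W) ∉ Submodule.span ℝ≥0 K' := by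
    intro h
    apply hz
    have h2 : ((W.subtype.restrictScalars ℝ≥0) ⟨z, hzK⟩) ∈
        (Submodule.span ℝ≥0 K').map (W.subtype.restrictScalars ℝ≥0) :=
      Submodule.mem_map_of_mem h
    rw [Submodule.map_span] at h2
    refine Submodule.span_mono ?_ h2
    rintro _ ⟨x, hx, rfl⟩
    exact hx
  obtain ⟨F, hF0, hF⟩ := exists_nonpos_functional_of_notMem_cone hK' hz'
  obtain ⟨G, hG⟩ := LinearMap.exists_extend (F : W →ₗ[ℝ] ℝ)
  have hGF : ∀ x : W, G x = F x := fun x => by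
    simpa using LinearMap.congr_fun hG x
  refine ⟨G.toContinuousLinearMap, ?_, ?_⟩
  · by_contra! hcon
    apply hF0
    have : ∀ x ∈ Submodule.span ℝ K', F x = 0 := by
      intro x hx
      induction hx using Submodule.span_induction with
      | mem x h => rw [← hGF]; exact hcon x h
      | zero => simp
      | add x y _ _ hx hy => simp [hx, hy]
      | smul a x _ hx => simp [hx]
    ext x
    simpa using this x (hK' ▸ Submodule.mem_top)
  · intro x hx
    have := hF ⟨x, Submodule.subset_span hx⟩ hx
    rw [← hGF] at this
    exact this

end Cone

/-! ### The mean as a finite convex combination of values -/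

section Representation

variable {α E : Type*} [MeasurableSpace α] [NormedAddCommGroup E] [NormedSpace ℝ E]
  [FiniteDimensional ℝ E]

/-- A mean-zero random vector vanishes on finitely supported probability weights that live on a set
of full measure, and any point of that set may be taken as an atom. -/
theorem exists_weights_of_integral_eq_zero (μ : Measure α) [IsProbabilityMeasure μ] {g : α → E}
    (hg : Integrable g μ) (h0 : ∫ x, g x ∂μ = 0) {S : Set α} (hS : ∀ᵐ x ∂μ, x ∈ S) :
    ∃ S' ⊆ S, (∀ᵐ x ∂μ, x ∈ S') ∧ ∀ x ∈ S', ∃ w : α →₀ ℝ≥0, (w.support : Set α) ⊆ S' ∧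
      w x ≠ 0 ∧ (w.sum fun _ a => a) = 1 ∧ Finsupp.linearCombination ℝ≥0 g w = 0 := by
  classical
  -- `S'` is chosen of full measure with the span of `g '' S'` of least dimension. A functional that
  -- is nonpositive on `g '' S'` has integral zero, hence vanishes almost everywhere; unless it
  -- vanishes on all of `g '' S'`, cutting down to its zero set would lower the dimension.
  let p : ℕ → Prop := fun d => ∃ S' ⊆ S, (∀ᵐ x ∂μ, x ∈ S') ∧
    Module.finrank ℝ (Submodule.span ℝ (g '' S')) = d
  have hp : ∃ d, p d := ⟨_, S, subset_rfl, hS, rfl⟩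
  obtain ⟨S', hS'S, hS', hd⟩ := Nat.find_spec hp
  refine ⟨S', hS'S, hS', fun x hx => ?_⟩
  have hmem : -g x ∈ Submodule.span ℝ≥0 (g '' S') := by
    by_contra hcon
    obtain ⟨F, ⟨_, ⟨y, hy, rfl⟩, hFy⟩, hF⟩ := exists_nonpos_functional_of_mem_span
      (Submodule.neg_mem _ (Submodule.subset_span (Set.mem_image_of_mem g hx))) hcon
    have hint : ∫ x, -(F (g x)) ∂μ = 0 := by
      rw [integral_neg, F.integral_comp_comm hg, h0, map_zero, neg_zero]
    have hae : (fun x => -(F (g x))) =ᵐ[μ] 0 := by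
      refine (integral_eq_zero_iff_of_nonneg_ae ?_ (F.integrable_comp hg).neg).1 hint
      · filter_upwards [hS'] with x hx
        simpa using hF _ (Set.mem_image_of_mem g hx)
    let S'' := {x ∈ S' | F (g x) = 0}
    have hlt : Submodule.span ℝ (g '' S'') < Submodule.span ℝ (g '' S') := by
      refine lt_of_le_of_ne (Submodule.span_mono (Set.image_mono fun x hx => hx.1)) fun heq => ?_
      have hy' : g y ∈ Submodule.span ℝ (g '' S'') :=
        heq ▸ Submodule.subset_span (Set.mem_image_of_mem g hy)
      have hle : Submodule.span ℝ (g '' S'') ≤ LinearMap.ker (F : E →ₗ[ℝ] ℝ) := by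
        rw [Submodule.span_le]
        rintro _ ⟨x, hx, rfl⟩
        exact hx.2
      exact hFy (hle hy')
    refine Nat.find_min hp (m := Module.finrank ℝ (Submodule.span ℝ (g '' S''))) ?_
      ⟨S'', fun x hx => hS'S hx.1, ?_, rfl⟩
    · rw [← hd]
      exact Submodule.finrank_lt_finrank_of_lt hlt
    · filter_upwards [hS', hae] with x hx hx0
      exact ⟨hx, by simpa using hx0⟩
  rw [Finsupp.mem_span_image_iff_linearCombination] at hmem
  obtain ⟨l, hl, hlx⟩ := hmem
  -- Writing `-g x` as a conic combination and adding `x` with weight `1` gives a null combination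
  -- charging `x`, which is then normalized.
  set v := l + Finsupp.single x 1 with hv
  set t : ℝ≥0 := v.sum fun _ a => a with ht
  have htl : t = (l.sum fun _ a => a) + 1 := by
    rw [ht, hv, Finsupp.sum_add_index' (by simp) (by simp)]
    simp
  have ht0 : t ≠ 0 := by rw [htl]; positivity
  refine ⟨t⁻¹ • v, ?_, ?_, ?_, ?_⟩
  · intro y hy
    have hy1 : v y ≠ 0 := by
      intro h
      simp [h] at hy
    by_cases hyx : y = x
    · exact hyx ▸ hx
    · apply (Finsupp.mem_supported _ _).1 hl
      simpa [hv, Finsupp.single_apply, Ne.symm hyx] using hy1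
  · simp [hv, ht0]
  · rw [Finsupp.sum_smul_index' (by simp)]
    simp only [smul_eq_mul]
    rw [← Finsupp.mul_sum, ← ht, inv_mul_cancel₀ ht0]
  · rw [map_smul, hv, map_add, hlx, Finsupp.linearCombination_single]
    simp

end Representation

/-! ### Carathéodory reduction of the number of atoms -/

section Reduction

/-- Finitely supported weights can be moved onto at most as many points as there are linear
constraints, without decreasing a given linear functional. -/
theorem exists_weights_card_support_le {α ι : Type*} [Fintype ι] (G : α → ι → ℝ) (ψ : α → ℝ)
    (a : ι → ℝ) (hG : ∀ x, ∑ i, a i * G x i = 1) (w : α →₀ ℝ≥0) :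
    ∃ w' : α →₀ ℝ≥0, w'.support ⊆ w.support ∧ w'.support.card ≤ Fintype.card ι ∧
      (∀ i, (w'.sum fun x c => (c : ℝ) * G x i) = w.sum fun x c => (c : ℝ) * G x i) ∧
      (w.sum fun x c => (c : ℝ) * ψ x) ≤ w'.sum fun x c => (c : ℝ) * ψ x := by
  classical
  induction hn : w.support.card using Nat.strong_induction_on generalizing w with
  | _ m ih =>
  by_cases hcard : w.support.card ≤ Fintype.card ι
  · exact ⟨w, subset_rfl, hcard, fun _ => rfl, le_rfl⟩
  push Not at hcard
  let T : (w.support → ℝ) →ₗ[ℝ] (ι → ℝ) :=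
    { toFun := fun v i => ∑ x, v x * G x i
      map_add' := fun u v => by ext i; simp [add_mul, Finset.sum_add_distrib]
      map_smul' := fun c v => by ext i; simp [Finset.mul_sum, mul_assoc] }
  have hker : LinearMap.ker T ≠ ⊥ := by
    apply LinearMap.ker_ne_bot_of_finrank_lt
    simpa using hcard
  obtain ⟨v₀, hv₀, hv₀0⟩ := Submodule.exists_mem_ne_zero_of_ne_bot hker
  obtain ⟨v, hv, hv0, hvψ⟩ : ∃ v ∈ LinearMap.ker T, v ≠ 0 ∧ 0 ≤ ∑ x, v x * ψ x := by
    rcases le_total 0 (∑ x, v₀ x * ψ x) with h | h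
    · exact ⟨v₀, hv₀, hv₀0, h⟩
    · refine ⟨-v₀, neg_mem hv₀, neg_ne_zero.2 hv₀0, ?_⟩
      simpa using h
  have hvG : ∀ i, ∑ x, v x * G x i = 0 := fun i => congrFun hv i
  -- The constant `1` is a combination of the constraints, so a kernel direction has total mass zero
  -- and, being nonzero, some negative entry.
  have hsum : ∑ x, v x = 0 := by
    calc ∑ x, v x = ∑ x, v x * ∑ i, a i * G x i := by simp [hG]
      _ = ∑ i, a i * ∑ x, v x * G x i := by
        simp_rw [Finset.mul_sum]
        rw [Finset.sum_comm]
        exact Finset.sum_congr rfl fun i _ => Finset.sum_congr rfl fun x _ => by ring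
      _ = 0 := Finset.sum_eq_zero fun i _ => by rw [hvG, mul_zero]
  obtain ⟨x₁, hx₁⟩ : ∃ x, v x < 0 := by
    by_contra! h
    apply hv0
    ext x
    exact (Finset.sum_eq_zero_iff_of_nonneg fun x _ => h x).1 hsum x (Finset.mem_univ x)
  obtain ⟨x₀, hx₀, hmin⟩ := Finset.exists_min_image (Finset.univ.filter fun x => v x < 0)
    (fun x => (w x : ℝ) / (-v x)) ⟨x₁, by simpa using hx₁⟩
  simp only [Finset.mem_filter, Finset.mem_univ, true_and] at hx₀ hmin
  -- The largest step that keeps all weights nonnegative; it removes the atom `x₀`.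
  set t : ℝ := (w x₀ : ℝ) / (-v x₀) with ht
  have ht0 : 0 ≤ t := div_nonneg (w x₀).2 (by linarith)
  have hnn : ∀ x : w.support, 0 ≤ (w x : ℝ) + t * v x := by
    intro x
    by_cases hx : v x < 0
    · have h1 := hmin x hx
      rw [le_div_iff₀ (by linarith)] at h1
      linarith
    · push Not at hx
      have := (w x).2
      positivity
  let u : α →₀ ℝ≥0 := Finsupp.onFinset w.support
    (fun x => if h : x ∈ w.support then Real.toNNReal ((w x : ℝ) + t * v ⟨x, h⟩) else 0)
    (fun x hx => by by_contra h; simp [h] at hx)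
  have hu : ∀ x : w.support, (u x : ℝ) = w x + t * v x := by
    intro x
    have : u x = Real.toNNReal ((w x : ℝ) + t * v x) := by
      simp only [u, Finsupp.onFinset_apply]
      rw [dif_pos x.2]
    rw [this, Real.coe_toNNReal _ (hnn x)]
  have husub : u.support ⊆ w.support := Finsupp.support_onFinset_subset
  have hux₀ : u x₀ = 0 := by
    have h1 := hu x₀
    have h2 : (w x₀ : ℝ) + t * v x₀ = 0 := by
      rw [ht]
      field_simp [hx₀.ne]
      ring
    rw [h2] at h1
    exact_mod_cast h1
  have hss : u.support ⊂ w.support := by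
    refine ⟨husub, fun h => ?_⟩
    have := h x₀.2
    simp [hux₀] at this
  have hsumu : ∀ H : α → ℝ, (u.sum fun x c => (c : ℝ) * H x) =
      (w.sum fun x c => (c : ℝ) * H x) + t * ∑ x : w.support, v x * H x := by
    intro H
    rw [Finsupp.sum_of_support_subset u husub _ (by simp), Finsupp.sum, ← Finset.sum_coe_sort,
      ← Finset.sum_coe_sort w.support, Finset.mul_sum, ← Finset.sum_add_distrib]
    refine Finset.sum_congr rfl fun x _ => ?_
    rw [hu]
    ring
  obtain ⟨w', h1, h2, h3, h4⟩ := ih u.support.card (hn ▸ Finset.card_lt_card hss) u rfl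
  refine ⟨w', h1.trans husub, h2, fun i => ?_, ?_⟩
  · rw [h3, hsumu, hvG, mul_zero, add_zero]
  · refine le_trans ?_ h4
    rw [hsumu]
    have := mul_nonneg ht0 hvψ
    linarith

theorem sum_mul_eq_of_linearCombination_sub_eq_zero {α ι : Type*} {w : α →₀ ℝ≥0}
    (hw : (w.sum fun _ a => a) = 1) {G : α → ι → ℝ} {M : ι → ℝ}
    (h : Finsupp.linearCombination ℝ≥0 (fun x i => G x i - M i) w = 0) (i : ι) :
    (w.sum fun x c => (c : ℝ) * G x i) = M i := by
  have hw' : ∑ x ∈ w.support, (w x : ℝ) = 1 := by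
    rw [Finsupp.sum] at hw
    exact_mod_cast hw
  have h1 := congrFun h i
  rw [Finsupp.linearCombination_apply, Finsupp.sum, Finset.sum_apply] at h1
  simp only [Pi.smul_apply, NNReal.smul_def, smul_eq_mul, mul_sub, Finset.sum_sub_distrib,
    ← Finset.sum_mul, hw', Pi.zero_apply, one_mul] at h1
  rw [Finsupp.sum]
  linarith

/-- A probability measure can be replaced by a discrete one on a given set of full measure, with at
most as many atoms as there are moments to be kept, without decreasing the mean of `ψ`. -/
theorem exists_weights_moments {α ι : Type*} [MeasurableSpace α] [Fintype ι] (μ : Measure α)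
    [IsProbabilityMeasure μ] {S : Set α} (hS : ∀ᵐ x ∂μ, x ∈ S) (G : α → ι → ℝ)
    (hG : ∀ i, Integrable (fun x => G x i) μ) (ψ : α → ℝ) (hψ : Integrable ψ μ)
    (a : ι → ℝ) (ha : ∀ x, ∑ i, a i * G x i = 1) :
    ∃ w : α →₀ ℝ≥0, (w.support : Set α) ⊆ S ∧ w.support.card ≤ Fintype.card ι ∧
      (∀ i, (w.sum fun x c => (c : ℝ) * G x i) = ∫ x, G x i ∂μ) ∧
      ∫ x, ψ x ∂μ ≤ w.sum fun x c => (c : ℝ) * ψ x := by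
  -- The objective `ψ` is carried along as an extra moment at first, so that the unreduced weights
  -- have exactly its mean; the reduction then lets it only increase.
  let H : α → Option ι → ℝ := fun x j => j.elim (ψ x) (G x)
  have hHi : ∀ j, Integrable (fun x => H x j) μ := by
    rintro (_ | i)
    · exact hψ
    · exact hG i
  have hgi : ∀ j, Integrable (fun x => H x j - ∫ y, H y j ∂μ) μ := fun j =>
    (hHi j).sub (integrable_const _)
  have hg0 : ∫ x, (fun j => H x j - ∫ y, H y j ∂μ) ∂μ = 0 := by
    ext j
    rw [eval_integral hgi, integral_sub (hHi j) (integrable_const _)]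
    simp
  obtain ⟨S', hS'S, hS', hw⟩ := exists_weights_of_integral_eq_zero μ (Integrable.of_eval hgi) hg0 hS
  obtain ⟨x, hx⟩ := hS'.exists
  obtain ⟨w, hwS, -, hw1, hw0⟩ := hw x hx
  have hmom := sum_mul_eq_of_linearCombination_sub_eq_zero hw1 hw0
  obtain ⟨w', h1, h2, h3, h4⟩ := exists_weights_card_support_le G ψ a ha w
  exact ⟨w', fun x hx => hS'S (hwS (h1 hx)), h2, fun i => (h3 i).trans (hmom (some i)),
    (hmom none).symm.le.trans h4⟩

end Reduction

/-! ### Relative interior points and linear growth of strictly convex functions -/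

section Growth

variable {E : Type*} [NormedAddCommGroup E] [NormedSpace ℝ E]

/-- A convex combination with positive weights is a relative interior point. -/
theorem exists_ball_subset_of_convex_combination {ι : Type*} [Fintype ι] {D : Set E}
    (hD : Convex ℝ D) (b : ι → E) (hb : ∀ i, b i ∈ D) (p : ι → ℝ) (hp : ∀ i, 0 < p i)
    (hp1 : ∑ i, p i = 1) {m : E} (hm : m = ∑ i, p i • b i) :
    ∃ r > 0, ∀ v ∈ Submodule.span ℝ (Set.range fun i => b i - m), ‖v‖ ≤ r → m + v ∈ D := by
  classical
  have : Nonempty ι := by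
    by_contra h
    rw [not_nonempty_iff] at h
    simp at hp1
  let T : (ι → ℝ) →ₗ[ℝ] E := Fintype.linearCombination ℝ fun i => b i - m
  have hT : LinearMap.range T = Submodule.span ℝ (Set.range fun i => b i - m) :=
    Fintype.range_linearCombination ℝ _
  obtain ⟨R, hR⟩ := T.rangeRestrict.exists_rightInverse_of_surjective
    (LinearMap.range_rangeRestrict T)
  let R' := R.toContinuousLinearMap
  obtain ⟨i₀, -, hi₀⟩ := Finset.exists_min_image Finset.univ p Finset.univ_nonempty
  set q := p i₀ with hq
  have hq0 : 0 < q := hp i₀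
  -- With `v = ∑ c i • (b i - m)` the new coefficients `p i * (1 - ∑ c) + c i` are at least `q - (1
  -- + card) * ‖R'‖ * ‖v‖`; the summand `1` beside `‖R'‖` only keeps `M` positive.
  set M : ℝ := (‖R'‖ + 1) * (1 + Fintype.card ι) with hM
  have hM0 : 0 < M := by positivity
  have hp1' : ∀ i, p i ≤ 1 := fun i => by
    rw [← hp1]
    exact Finset.single_le_sum (f := p) (fun j _ => (hp j).le) (Finset.mem_univ i)
  refine ⟨q / M, by positivity, fun v hv hvr => ?_⟩
  rw [← hT] at hv
  set c := R' ⟨v, hv⟩ with hc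
  have hTc : ∑ i, c i • (b i - m) = v := by
    have := congrArg Subtype.val (LinearMap.congr_fun hR ⟨v, hv⟩)
    simpa [T, Fintype.linearCombination_apply, hc, R'] using this
  have hcn : ∀ i, |c i| ≤ ‖R'‖ * ‖v‖ := fun i =>
    (norm_le_pi_norm c i).trans (R'.le_opNorm _)
  have hbound : ‖R'‖ * ‖v‖ * (1 + Fintype.card ι) ≤ q := by
    have h1 : ‖v‖ * M ≤ q := by rwa [le_div_iff₀ hM0] at hvr
    have h2 : ‖R'‖ * ‖v‖ * (1 + Fintype.card ι) ≤ ‖v‖ * M := by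
      rw [hM]
      have : 0 ≤ ‖v‖ * (1 + (Fintype.card ι : ℝ)) := by positivity
      nlinarith
    exact h2.trans h1
  have hsumc : |∑ i, c i| ≤ Fintype.card ι * (‖R'‖ * ‖v‖) := by
    refine (Finset.abs_sum_le_sum_abs _ _).trans ?_
    refine (Finset.sum_le_card_nsmul _ _ _ fun i _ => hcn i).trans ?_
    simp
  have hmv : m + v = ∑ i, (p i * (1 - ∑ j, c j) + c i) • b i := by
    have h1 : v = ∑ i, c i • b i - (∑ i, c i) • m := by
      rw [← hTc]
      simp [smul_sub, Finset.sum_sub_distrib, Finset.sum_smul]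
    have h2 : ∑ i, (p i * (1 - ∑ j, c j) + c i) • b i =
        (1 - ∑ j, c j) • m + ∑ i, c i • b i := by
      rw [hm, Finset.smul_sum, ← Finset.sum_add_distrib]
      refine Finset.sum_congr rfl fun i _ => ?_
      rw [add_smul, mul_comm, mul_smul]
    rw [h2, h1, sub_smul, one_smul]
    abel
  rw [hmv]
  refine hD.sum_mem (fun i _ => ?_) ?_ fun i _ => hb i
  · have h1 := hi₀ i (Finset.mem_univ i)
    have h2 := neg_abs_le (c i)
    have h3 := hcn i
    have h4 := le_abs_self (∑ i, c i)
    have h5 : p i * (∑ j, c j) ≤ Fintype.card ι * (‖R'‖ * ‖v‖) := by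
      calc p i * (∑ j, c j) ≤ p i * |∑ j, c j| := by
            gcongr
            exact (hp i).le
        _ ≤ 1 * |∑ j, c j| := by
            gcongr
            exact hp1' i
        _ ≤ _ := by rwa [one_mul]
    nlinarith
  · rw [Finset.sum_add_distrib, ← Finset.sum_mul, hp1]
    ring

/-- A strictly convex function grows linearly above any affine minorant that nearly touches it at
a relative interior point. -/
theorem exists_growth_of_strictConvexOn [FiniteDimensional ℝ E] {D : Set E} {φ : E → ℝ}
    (hφ : StrictConvexOn ℝ D φ) (hc : ContinuousOn φ D) {V : Submodule ℝ E} {m : E} {r : ℝ} (hr : 0 < r)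
    (hball : ∀ v ∈ V, ‖v‖ ≤ r → m + v ∈ D) :
    ∃ δ > 0, ∃ C : ℝ, ∀ (a : ℝ) (L : E →ₗ[ℝ] ℝ), (∀ x ∈ D, a + L x ≤ φ x) → φ m ≤ a + L m + δ →
      ∀ x ∈ D, x - m ∈ V → ‖x - m‖ ≤ r + C * (φ x - (a + L x)) := by
  have hm : m ∈ D := by simpa using hball 0 V.zero_mem (by simpa using hr.le)
  -- The midpoint gap of strict convexity is uniform on the compact sphere of radius `r` in `V`.
  obtain ⟨σ, hσ, hgap⟩ : ∃ σ > 0, ∀ u ∈ V, ‖u‖ = r →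
      φ (m + (2⁻¹ : ℝ) • u) + σ ≤ (φ m + φ (m + u)) / 2 := by
    let K : Set E := (V : Set E) ∩ Metric.sphere 0 r
    have hK : IsCompact K := (isCompact_sphere 0 r).inter_left V.closed_of_finiteDimensional
    let s : E → ℝ := fun u => (φ m + φ (m + u)) / 2 - φ (m + (2⁻¹ : ℝ) • u)
    have hs : ContinuousOn s K := by
      have h1 : ContinuousOn (fun u => φ (m + u)) K :=
        hc.comp (by fun_prop) fun u hu => hball u hu.1
          (by simpa using (mem_sphere_zero_iff_norm.1 hu.2).le)
      have h2 : ContinuousOn (fun u => φ (m + (2⁻¹ : ℝ) • u)) K :=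
        hc.comp (by fun_prop) fun u hu => hball _ (V.smul_mem _ hu.1) (by
          rw [norm_smul, mem_sphere_zero_iff_norm.1 hu.2]
          norm_num
          linarith)
      exact ((continuousOn_const.add h1).div_const 2).sub h2
    have hpos : ∀ u ∈ K, 0 < s u := by
      intro u hu
      have hur := mem_sphere_zero_iff_norm.1 hu.2
      have hne : m ≠ m + u := by
        intro h
        have : u = 0 := by simpa using h
        rw [this] at hur
        simp at hur
        exact hr.ne hur
      have h1 := hφ.2 hm (hball u hu.1 hur.le) hne (show (0 : ℝ) < 2⁻¹ by norm_num)
        (show (0 : ℝ) < 2⁻¹ by norm_num) (by norm_num)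
      have h2 : (2⁻¹ : ℝ) • m + (2⁻¹ : ℝ) • (m + u) = m + (2⁻¹ : ℝ) • u := by
        module
      rw [h2] at h1
      simp only [smul_eq_mul] at h1
      simp only [s]
      linarith
    rcases K.eq_empty_or_nonempty with hKe | hKn
    · refine ⟨1, one_pos, fun u hu hur => ?_⟩
      have : u ∈ K := ⟨hu, mem_sphere_zero_iff_norm.2 hur⟩
      simp [hKe] at this
    · obtain ⟨u₀, hu₀, hmin⟩ := hK.exists_isMinOn hKn hs
      refine ⟨s u₀, hpos u₀ hu₀, fun u hu hur => ?_⟩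
      have h1 : s u₀ ≤ s u := hmin ⟨hu, mem_sphere_zero_iff_norm.2 hur⟩
      have h2 : s u = (φ m + φ (m + u)) / 2 - φ (m + (2⁻¹ : ℝ) • u) := rfl
      linarith
  -- Let `h ≥ 0` be `φ` minus the minorant, with `h m ≤ σ / 2`. For `x` beyond the sphere, convexity
  -- at `u = t • (x - m)` and the gap give `σ ≤ h m + t * h x / 2`, hence `σ ≤ t * h x` with `t = r
  -- / ‖x - m‖`.
  refine ⟨σ / 2, by positivity, r / σ, fun a L hL hLm x hx hxV => ?_⟩
  have hex := hL x hx
  rcases le_or_gt ‖x - m‖ r with h | h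
  · have : 0 ≤ r / σ * (φ x - (a + L x)) := mul_nonneg (by positivity) (by linarith)
    linarith
  have hn : 0 < ‖x - m‖ := hr.trans h
  set t : ℝ := r / ‖x - m‖ with ht
  have ht0 : 0 < t := by positivity
  have ht1 : t ≤ 1 := by rw [ht, div_le_one hn]; exact h.le
  have htn : t * ‖x - m‖ = r := by rw [ht]; field_simp
  set u : E := t • (x - m) with hu
  have huV : u ∈ V := V.smul_mem _ hxV
  have hur : ‖u‖ = r := by rw [hu, norm_smul, Real.norm_of_nonneg ht0.le, htn]
  have h1 := hgap u huV hur
  have h2 := hL _ (hball ((2⁻¹ : ℝ) • u) (V.smul_mem _ huV) (by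
    rw [norm_smul, hur]; norm_num; linarith))
  have h3 : φ (m + u) ≤ (1 - t) * φ m + t * φ x := by
    have h4 := hφ.convexOn.2 hm hx (show 0 ≤ 1 - t by linarith) ht0.le (by ring)
    have h5 : (1 - t) • m + t • x = m + u := by rw [hu]; module
    rwa [h5] at h4
  have h6 : L u = t * (L x - L m) := by rw [hu, map_smul, map_sub, smul_eq_mul]
  simp only [map_add, map_smul, smul_eq_mul] at h2
  have h7 : σ ≤ t * (φ x - (a + L x)) := by
    have h8 := hL m hm
    nlinarith
  have h9 : ‖x - m‖ = r / t := by rw [← htn]; field_simp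
  have h10 : r / t ≤ r / σ * (φ x - (a + L x)) := by
    rw [div_le_iff₀ ht0]
    have : r / σ * σ ≤ r / σ * (t * (φ x - (a + L x))) := by gcongr
    rw [div_mul_cancel₀ _ hσ.ne'] at this
    linarith
  linarith

end Growth

/-! ### Nonnegativity of the divergence and measurability -/

section Bregman

variable {n : ℕ} {Ω : Set (Fin n → EReal)} {φ : EuclideanSpace ℝ (Fin n) → ℝ}

/-- On the segment from `v` to `u` the function is convex in one variable, so its slope is at least
its derivative at `v`. The segment lies in `D`, so the derivative within `D` suffices even if `D`
has no interior. -/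
theorem bregman_nonneg {D : Set (EuclideanSpace ℝ (Fin n))} (hφ : ConvexOn ℝ D φ)
    (hd : DifferentiableOn ℝ φ D) {u v : EuclideanSpace ℝ (Fin n)} (hu : u ∈ D) (hv : v ∈ D) :
    0 ≤ bregman D φ u v := by
  have hinner : inner ℝ (u - v) (gradientWithin φ D v) = fderivWithin ℝ φ D v (u - v) := by
    rw [real_inner_comm, gradientWithin, InnerProductSpace.toDual_symm_apply]
  have hmaps : Set.MapsTo (fun t : ℝ => v + t • (u - v)) (Set.Icc 0 1) D := by
    intro t ht
    have := hφ.1 hv hu (show 0 ≤ 1 - t by linarith [ht.2]) ht.1 (by ring)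
    convert! this using 1
    module
  have hline : HasDerivWithinAt (fun t : ℝ => v + t • (u - v)) (u - v) (Set.Icc 0 1) 0 := by
    simpa using (((hasDerivAt_id (0 : ℝ)).smul_const (u - v)).const_add v).hasDerivWithinAt
  have hφv : HasFDerivWithinAt φ (fderivWithin ℝ φ D v) D (v + (0 : ℝ) • (u - v)) := by
    simpa using (hd v hv).hasFDerivWithinAt
  have hcomp := hφv.comp_hasDerivWithinAt (0 : ℝ) hline hmaps
  have hconv : ConvexOn ℝ (Set.Icc (0 : ℝ) 1) (φ ∘ fun t : ℝ => v + t • (u - v)) := by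
    refine ⟨convex_Icc 0 1, fun s hs t ht a b ha hb hab => ?_⟩
    have := hφ.2 (hmaps hs) (hmaps ht) ha hb hab
    refine le_trans (le_of_eq ?_) this
    simp only [Function.comp_apply, smul_eq_mul]
    congr 1
    have hb' : b = 1 - a := by linarith
    subst hb'
    module
  have := hconv.le_slope_of_hasDerivWithinAt (x := 0) (y := 1) (by simp) (by simp) one_pos hcomp
  rw [slope_def_field] at this
  simp only [Function.comp_apply, one_smul, zero_smul, add_zero, add_sub_cancel, sub_zero,
    div_one] at this
  rw [bregman, hinner]
  linarith

theorem toVec_mem_finitePart (x : Ω) (hx : IsFinitePoint x.1) : toVec x.1 ∈ finitePart Ω := by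
  have : (fun i => ((toVec x.1 i : ℝ) : EReal)) = x.1 := by
    ext i
    simp only [toVec]
    exact EReal.coe_toReal (hx i).2 (hx i).1
  rw [finitePart, Set.mem_ofPred_eq, this]
  exact x.2

theorem measurable_toVec : Measurable fun x : Ω => toVec x.1 := by
  refine (PiLp.continuous_toLp 2 _).measurable.comp ?_
  exact measurable_pi_lambda _ fun i =>
    measurable_ereal_toReal.comp ((measurable_pi_apply i).comp measurable_subtype_coe)

theorem measurableSet_isFinitePoint : MeasurableSet {x : Ω | IsFinitePoint x.1} := by
  have : {x : Ω | IsFinitePoint x.1} = ⋂ i, (fun x : Ω => x.1 i) ⁻¹' {⊥, ⊤}ᶜ := by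
    ext x
    simp [IsFinitePoint]
  rw [this]
  exact MeasurableSet.iInter fun i => ((measurable_pi_apply i).comp measurable_subtype_coe)
    (by measurability)

theorem continuousOn_comp_toVec (hφ : ContinuousOn φ (finitePart Ω)) :
    ContinuousOn (fun x : Ω => φ (toVec x.1)) {x : Ω | IsFinitePoint x.1} := by
  refine hφ.comp ?_ fun x hx => toVec_mem_finitePart x hx
  refine (PiLp.continuous_toLp 2 _).comp_continuousOn ?_
  refine continuousOn_pi.2 fun i => ?_
  refine EReal.continuousOn_toReal.comp
    (((continuous_apply i).comp continuous_subtype_val).continuousOn) fun x hx => ?_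
  simpa [not_or] using hx i

theorem aemeasurable_comp_toVec (hφ : ContinuousOn φ (finitePart Ω)) {μ : Measure Ω}
    (hμ : ∀ᵐ x ∂μ, IsFinitePoint x.1) : AEMeasurable (fun x : Ω => φ (toVec x.1)) μ := by
  have := (continuousOn_comp_toVec hφ).aemeasurable (μ := μ) measurableSet_isFinitePoint
  have h2 : μ.restrict {x : Ω | IsFinitePoint x.1} = μ := Measure.restrict_eq_self_of_ae_mem hμ
  rwa [h2] at this

end Bregman

/-! ### Finitely supported measures -/

section Discrete

variable {α : Type*} [MeasurableSpace α]

/-- The measure with point masses `w x` at the points of the support of `w`. -/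
noncomputable def discreteMeasure (w : α →₀ ℝ≥0) : Measure α :=
  ∑ x ∈ w.support, w x • Measure.dirac x

theorem isProbabilityMeasure_discreteMeasure {w : α →₀ ℝ≥0} (hw : (w.sum fun _ a => a) = 1) :
    IsProbabilityMeasure (discreteMeasure w) := by
  refine ⟨?_⟩
  simp only [discreteMeasure, Measure.coe_finsetSum, Finset.sum_apply, Measure.smul_apply,
    measure_univ]
  rw [Finsupp.sum] at hw
  have := congrArg ((↑) : ℝ≥0 → ℝ≥0∞) hw
  push_cast at this
  simpa [ENNReal.smul_def] using this

/-- The discrete probability measure with weights `w`. -/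
noncomputable def discreteProb (w : α →₀ ℝ≥0) (hw : (w.sum fun _ a => a) = 1) :
    ProbabilityMeasure α :=
  ⟨discreteMeasure w, isProbabilityMeasure_discreteMeasure hw⟩

@[simp]
theorem coe_discreteProb (w : α →₀ ℝ≥0) (hw : (w.sum fun _ a => a) = 1) :
    (discreteProb w hw : Measure α) = discreteMeasure w := rfl

variable [MeasurableSingletonClass α]

variable {E : Type*} [NormedAddCommGroup E]

theorem integrable_discreteMeasure (w : α →₀ ℝ≥0) (F : α → E) :
    Integrable F (discreteMeasure w) := by
  rw [discreteMeasure, integrable_finsetSum_measure]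
  exact fun x _ => (integrable_dirac enorm_lt_top).smul_measure_nnreal

theorem integral_discreteMeasure [NormedSpace ℝ E] [CompleteSpace E] (w : α →₀ ℝ≥0)
    (F : α → E) : ∫ x, F x ∂(discreteMeasure w) = w.sum fun x c => (c : ℝ) • F x := by
  rw [discreteMeasure, integral_finsetSum_measure
    fun x _ => (integrable_dirac enorm_lt_top).smul_measure_nnreal]
  refine Finset.sum_congr rfl fun x _ => ?_
  rw [integral_smul_nnreal_measure, integral_dirac, NNReal.smul_def]

theorem ae_discreteMeasure {w : α →₀ ℝ≥0} {p : α → Prop} (h : ∀ x ∈ w.support, p x) :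
    ∀ᵐ x ∂(discreteMeasure w), p x := by
  have : ∀ x ∈ w.support, (w x • Measure.dirac x) {y | ¬ p y} = 0 := by
    intro x hx
    simp [h x hx]
  rw [ae_iff, discreteMeasure, Measure.coe_finsetSum, Finset.sum_apply]
  exact Finset.sum_eq_zero this

theorem innerRegular_discreteMeasure [TopologicalSpace α] (w : α →₀ ℝ≥0) :
    (discreteMeasure w).InnerRegular := by
  have h : ∀ x : α, (Measure.dirac x).InnerRegular := by
    refine fun x => ⟨fun U hU r hr => ?_⟩
    by_cases hx : x ∈ U
    · refine ⟨{x}, by simpa using hx, isCompact_singleton, ?_⟩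
      simpa [hx] using hr
    · simp [hx] at hr
  have : ∀ x, (w x • (Measure.dirac x : Measure α)).InnerRegular := fun x => by
    have := h x
    infer_instance
  rw [discreteMeasure]
  infer_instance

theorem hasAtMostMassPoints_discreteProb {n : ℕ} {Ω : Set (Fin n → EReal)} {w : Ω →₀ ℝ≥0}
    (hw : (w.sum fun _ a => a) = 1) {d : ℕ} (hd : w.support.card ≤ d) :
    HasAtMostMassPoints (discreteProb w hw) d :=
  ⟨w.support, hd, ae_discreteMeasure (p := fun x => x ∈ w.support) fun _ hx => hx⟩

end Discrete

/-! ### Mixtures of two priors -/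

section Mixture

variable {α : Type*} [MeasurableSpace α]

/-- The mixture `a Q + b P` of two probability measures. -/
noncomputable def mixture (a b : ℝ≥0) (hab : a + b = 1) (Q P : ProbabilityMeasure α) :
    ProbabilityMeasure α :=
  ⟨a • (Q : Measure α) + b • (P : Measure α), ⟨by
    simp only [Measure.add_apply, Measure.smul_apply, measure_univ, ENNReal.smul_def, smul_eq_mul,
      mul_one]
    exact_mod_cast hab⟩⟩

theorem coe_mixture (a b : ℝ≥0) (hab : a + b = 1) (Q P : ProbabilityMeasure α) :
    (mixture a b hab Q P : Measure α) = a • (Q : Measure α) + b • (P : Measure α) := rfl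

theorem lintegral_mixture (a b : ℝ≥0) (hab : a + b = 1) (Q P : ProbabilityMeasure α)
    (F : α → ℝ≥0∞) :
    ∫⁻ x, F x ∂(mixture a b hab Q P : Measure α) =
      a * ∫⁻ x, F x ∂(Q : Measure α) + b * ∫⁻ x, F x ∂(P : Measure α) := by
  rw [coe_mixture, lintegral_add_measure, lintegral_smul_measure, lintegral_smul_measure]
  rfl

theorem weights_add_eq_one (j : ℕ) : (j / (j + 1) : ℝ≥0) + (1 / (j + 1) : ℝ≥0) = 1 := by
  rw [← add_div, div_self (by positivity)]

theorem tendsto_mixture [TopologicalSpace α] [OpensMeasurableSpace α]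
    (Q P : ProbabilityMeasure α) :
    Filter.Tendsto (fun j : ℕ => mixture _ _ (weights_add_eq_one j) Q P) Filter.atTop (𝓝 Q) := by
  rw [ProbabilityMeasure.tendsto_iff_forall_integral_tendsto]
  intro F
  have hF : ∀ μ : ProbabilityMeasure α, Integrable (fun x => F x) (μ : Measure α) :=
    fun μ => F.integrable _
  have heq : ∀ j : ℕ, ∫ x, F x ∂(mixture _ _ (weights_add_eq_one j) Q P : Measure α) =
      (j / (j + 1) : ℝ) * ∫ x, F x ∂(Q : Measure α) +
        (1 / (j + 1) : ℝ) * ∫ x, F x ∂(P : Measure α) := by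
    intro j
    rw [coe_mixture, integral_add_measure ((hF Q).smul_measure_nnreal)
      ((hF P).smul_measure_nnreal), integral_smul_nnreal_measure, integral_smul_nnreal_measure]
    simp [NNReal.smul_def]
  simp_rw [heq]
  have h1 : Filter.Tendsto (fun j : ℕ => (j / (j + 1) : ℝ)) Filter.atTop (𝓝 1) :=
    tendsto_natCast_div_add_atTop 1
  have h2 : Filter.Tendsto (fun j : ℕ => (1 / (j + 1) : ℝ)) Filter.atTop (𝓝 0) :=
    tendsto_one_div_add_atTop_nhds_zero_nat
  simpa using (h1.mul_const (∫ x, F x ∂(Q : Measure α))).add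
    (h2.mul_const (∫ x, F x ∂(P : Measure α)))

end Mixture

/-! ### The moment set and semicontinuity along mixtures -/

section MomentSet

variable {n k : ℕ} {Ω : Set (Fin n → EReal)} {f : Fin k → Ω → EReal} {c : Fin k → ℝ}

theorem discreteProb_mem_momentSet {w : Ω →₀ ℝ≥0} (hw : (w.sum fun _ a => a) = 1)
    (hfin : ∀ i, ∀ x ∈ w.support, f i x ≠ ⊥ ∧ f i x ≠ ⊤)
    (hc : ∀ i, (w.sum fun x a => (a : ℝ) * (f i x).toReal) ≤ c i) :
    discreteProb w hw ∈ momentSet f c := by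
  have := innerRegular_discreteMeasure w
  have := isProbabilityMeasure_discreteMeasure hw
  refine ⟨?_, fun i => ⟨ae_discreteMeasure (hfin i), integrable_discreteMeasure _ _, ?_⟩⟩
  · rw [coe_discreteProb]
    infer_instance
  · rw [coe_discreteProb, integral_discreteMeasure]
    exact hc i

theorem mixture_mem_momentSet {Q P : ProbabilityMeasure Ω} (hQ : Q ∈ momentSet f c)
    (hP : P ∈ momentSet f c) {a b : ℝ≥0} (hab : a + b = 1) :
    mixture a b hab Q P ∈ momentSet f c := by
  have := hQ.1
  have := hP.1
  refine ⟨?_, fun i => ?_⟩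
  -- Inner regularity passes to sums and multiples, and for a finite measure it gives back
  -- regularity.
  · have h1 : (a • (Q : Measure Ω) + b • (P : Measure Ω)).InnerRegular := inferInstance
    have h2 : IsFiniteMeasure (a • (Q : Measure Ω) + b • (P : Measure Ω)) := inferInstance
    rw [coe_mixture]
    infer_instance
  · obtain ⟨hQ1, hQ2, hQ3⟩ := hQ.2 i
    obtain ⟨hP1, hP2, hP3⟩ := hP.2 i
    rw [coe_mixture]
    refine ⟨?_, hQ2.smul_measure_nnreal.add_measure hP2.smul_measure_nnreal, ?_⟩
    · rw [ae_add_measure_iff]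
      exact ⟨Measure.ae_smul_measure hQ1 a, Measure.ae_smul_measure hP1 b⟩
    · rw [integral_add_measure hQ2.smul_measure_nnreal hP2.smul_measure_nnreal,
        integral_smul_nnreal_measure, integral_smul_nnreal_measure, NNReal.smul_def,
        NNReal.smul_def, smul_eq_mul, smul_eq_mul]
      have h1 : (a : ℝ) + b = 1 := by exact_mod_cast hab
      calc _ ≤ (a : ℝ) * c i + b * c i := by gcongr
        _ = c i := by rw [← add_mul, h1, one_mul]

variable {𝒴 : Type*} [MeasurableSpace 𝒴] {φ : EuclideanSpace ℝ (Fin n) → ℝ} {κ : Kernel Ω 𝒴}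

/-- The mixtures tend to `Q` inside the moment set but always charge `P`, so an estimator with
finite loss under such a mixture also has finite loss under `P`. -/
theorem exists_mixture_bregmanRisk_lt
    (husc : UpperSemicontinuousOn (bregmanRisk φ κ) (momentSet f c))
    {Q P : ProbabilityMeasure Ω} (hQ : Q ∈ momentSet f c) (hP : P ∈ momentSet f c) {r : ℝ≥0∞}
    (hr : bregmanRisk φ κ Q < r) :
    ∀ᶠ j : ℕ in Filter.atTop, bregmanRisk φ κ (mixture _ _ (weights_add_eq_one j) Q P) < r := by
  have h : Filter.Tendsto (fun j : ℕ => mixture _ _ (weights_add_eq_one j) Q P) Filter.atTop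
      (𝓝[momentSet f c] Q) :=
    tendsto_nhdsWithin_iff.2 ⟨tendsto_mixture Q P, Filter.Eventually.of_forall fun j =>
      mixture_mem_momentSet hQ hP _⟩
  exact h.eventually (husc Q hQ r hr)

/-- Upper semicontinuity forces the risk to be finite on the whole moment set once it is finite at
one point. -/
theorem bregmanRisk_lt_top_of_lt_top
    (husc : UpperSemicontinuousOn (bregmanRisk φ κ) (momentSet f c))
    {Q P : ProbabilityMeasure Ω} (hQ : Q ∈ momentSet f c) (hP : P ∈ momentSet f c)
    (hr : bregmanRisk φ κ Q < ⊤) : bregmanRisk φ κ P < ⊤ := by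
  obtain ⟨j, hj⟩ := (exists_mixture_bregmanRisk_lt husc hQ hP hr).exists
  rw [bregmanRisk, iInf_lt_iff] at hj
  obtain ⟨v, hv⟩ := hj
  rw [lintegral_mixture] at hv
  refine lt_of_le_of_lt (iInf_le _ v) ?_
  have h1 := (ENNReal.add_lt_top.1 hv).2
  refine lt_top_iff_ne_top.2 fun h => ?_
  rw [h, ENNReal.mul_top (by simp)] at h1
  exact lt_irrefl _ h1

end MomentSet

/-! ### The risk in terms of moments -/

section Risk

variable {n : ℕ} {Ω : Set (Fin n → EReal)} {φ : EuclideanSpace ℝ (Fin n) → ℝ}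
  {𝒴 : Type*} [MeasurableSpace 𝒴] {κ : Kernel Ω 𝒴}

theorem bregman_eq (D : Set (EuclideanSpace ℝ (Fin n))) (φ : EuclideanSpace ℝ (Fin n) → ℝ)
    (u v : EuclideanSpace ℝ (Fin n)) :
    bregman D φ u v =
      φ u - ((φ v - inner ℝ v (gradientWithin φ D v)) + inner ℝ u (gradientWithin φ D v)) := by
  rw [bregman, inner_sub_left]
  ring

theorem loss_of_isFinitePoint {x : Ω} (hx : IsFinitePoint x.1) (v : EuclideanSpace ℝ (Fin n)) :
    loss Ω φ x.1 v = ENNReal.ofReal (bregman (finitePart Ω) φ (toVec x.1) v) :=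
  if_pos hx

/-- The expected loss of the estimator `v` in terms of moments of the prior. -/
noncomputable def expectedLoss (φ : EuclideanSpace ℝ (Fin n) → ℝ) (κ : Kernel Ω 𝒴)
    [Fintype 𝒴] (μ : Measure Ω) (v : 𝒴 → finitePart Ω) : ℝ :=
  ∫ x, φ (toVec x.1) ∂μ - ∑ y,
    ((φ (v y).1 - inner ℝ (v y).1 (gradientWithin φ (finitePart Ω) (v y).1)) *
        ∫ x, (κ x).real {y} ∂μ +
      inner ℝ (∫ x, (κ x).real {y} • toVec x.1 ∂μ) (gradientWithin φ (finitePart Ω) (v y).1))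

/-- Changing the estimate at `y` into the conditional mean `m` improves the expected loss by the
divergence between `m` and the estimate. -/
theorem expectedLoss_sub_update [Fintype 𝒴] [DecidableEq 𝒴] {μ : Measure Ω}
    (v : 𝒴 → finitePart Ω) (y : 𝒴) (m : finitePart Ω)
    (hm : ∫ x, (κ x).real {y} • toVec x.1 ∂μ = (∫ x, (κ x).real {y} ∂μ) • m.1) :
    expectedLoss φ κ μ v - expectedLoss φ κ μ (Function.update v y m) =
      (∫ x, (κ x).real {y} ∂μ) * bregman (finitePart Ω) φ m.1 (v y).1 := by
  rw [expectedLoss, expectedLoss, sub_sub_sub_cancel_left, ← Finset.sum_sub_distrib,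
    Finset.sum_eq_single_of_mem y (Finset.mem_univ y)]
  · rw [Function.update_self, hm, bregman_eq, real_inner_smul_left, real_inner_smul_left]
    ring
  · intro z _ hz
    rw [Function.update_of_ne hz, sub_self]

variable [MeasurableSingletonClass 𝒴]

theorem measurable_kernel_real (κ : Kernel Ω 𝒴) (y : 𝒴) : Measurable fun x => (κ x).real {y} :=
  (κ.measurable_coe (measurableSet_singleton y)).ennreal_toReal

theorem integrable_kernel_real (κ : Kernel Ω 𝒴) [IsMarkovKernel κ] (μ : Measure Ω)
    [IsFiniteMeasure μ] (y : 𝒴) : Integrable (fun x => (κ x).real {y}) μ :=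
  Integrable.of_bound (measurable_kernel_real κ y).aestronglyMeasurable 1
    (Filter.Eventually.of_forall fun x => by
      rw [Real.norm_of_nonneg measureReal_nonneg]
      exact measureReal_le_one)

theorem lintegral_loss [Fintype 𝒴] (x : Ω) (v : 𝒴 → finitePart Ω) :
    ∫⁻ y, loss Ω φ x.1 (v y).1 ∂(κ x) = ∑ y, loss Ω φ x.1 (v y).1 * κ x {y} :=
  lintegral_fintype _

variable [IsMarkovKernel κ]

theorem integrable_kernel_smul {E : Type*} [NormedAddCommGroup E] [NormedSpace ℝ E]
    {μ : Measure Ω} {g : Ω → E} (hg : Integrable g μ) (y : 𝒴) :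
    Integrable (fun x => (κ x).real {y} • g x) μ :=
  hg.bdd_smul 1 (measurable_kernel_real κ y).aestronglyMeasurable
    (Filter.Eventually.of_forall fun x => by
      rw [Real.norm_of_nonneg measureReal_nonneg]
      exact measureReal_le_one)

variable [Fintype 𝒴]

theorem sum_kernel_real (κ : Kernel Ω 𝒴) [IsMarkovKernel κ] (x : Ω) :
    ∑ y, (κ x).real {y} = 1 := by
  rw [sum_measureReal_singleton, Finset.coe_univ, probReal_univ]

theorem lintegral_loss_of_isFinitePoint (hφ : ConvexOn ℝ (finitePart Ω) φ)
    (hd : DifferentiableOn ℝ φ (finitePart Ω)) {x : Ω} (hx : IsFinitePoint x.1)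
    (v : 𝒴 → finitePart Ω) :
    ∫⁻ y, loss Ω φ x.1 (v y).1 ∂(κ x) =
      ENNReal.ofReal (∑ y, (κ x).real {y} * bregman (finitePart Ω) φ (toVec x.1) (v y).1) := by
  rw [lintegral_loss, ENNReal.ofReal_sum_of_nonneg fun y _ => mul_nonneg measureReal_nonneg
    (bregman_nonneg hφ hd (toVec_mem_finitePart x hx) (v y).2)]
  refine Finset.sum_congr rfl fun y _ => ?_
  rw [loss_of_isFinitePoint hx, ENNReal.ofReal_mul measureReal_nonneg, ofReal_measureReal, mul_comm]

/-- Since the kernel weights sum to `1`, averaging the divergence over `y` isolates `φ(x)` and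
leaves terms linear in `κ x {y}` and `κ x {y} • x`. -/
theorem lintegral_lintegral_loss (hφ : ConvexOn ℝ (finitePart Ω) φ)
    (hd : DifferentiableOn ℝ φ (finitePart Ω)) {μ : Measure Ω} [IsProbabilityMeasure μ]
    (hfin : ∀ᵐ x ∂μ, IsFinitePoint x.1) (hX : Integrable (fun x : Ω => toVec x.1) μ)
    (hφX : Integrable (fun x : Ω => φ (toVec x.1)) μ) (v : 𝒴 → finitePart Ω) :
    0 ≤ expectedLoss φ κ μ v ∧
      ∫⁻ x, ∫⁻ y, loss Ω φ x.1 (v y).1 ∂(κ x) ∂μ = ENNReal.ofReal (expectedLoss φ κ μ v) := by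
  let A : 𝒴 → ℝ := fun y => φ (v y).1 - inner ℝ (v y).1 (gradientWithin φ (finitePart Ω) (v y).1)
  let g : 𝒴 → EuclideanSpace ℝ (Fin n) := fun y => gradientWithin φ (finitePart Ω) (v y).1
  let F : Ω → ℝ := fun x => ∑ y, (κ x).real {y} * bregman (finitePart Ω) φ (toVec x.1) (v y).1
  have hF : ∀ x, F x = φ (toVec x.1) -
      ∑ y, (A y * (κ x).real {y} + inner ℝ ((κ x).real {y} • toVec x.1) (g y)) := by
    intro x
    have h1 : φ (toVec x.1) = ∑ y, (κ x).real {y} * φ (toVec x.1) := by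
      rw [← Finset.sum_mul, sum_kernel_real, one_mul]
    rw [h1, ← Finset.sum_sub_distrib]
    refine Finset.sum_congr rfl fun y _ => ?_
    rw [bregman_eq, real_inner_smul_left]
    simp only [A, g]
    ring
  have hterm1 : ∀ y, Integrable (fun x => A y * (κ x).real {y}) μ := fun y =>
    (integrable_kernel_real κ μ y).const_mul _
  have hterm2 : ∀ y, Integrable (fun x : Ω => inner ℝ ((κ x).real {y} • toVec x.1) (g y)) μ :=
    fun y => (integrable_kernel_smul hX y).inner_const _
  have hterm : ∀ y ∈ Finset.univ, Integrable (fun x : Ω =>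
      A y * (κ x).real {y} + inner ℝ ((κ x).real {y} • toVec x.1) (g y)) μ :=
    fun y _ => (hterm1 y).add (hterm2 y)
  have hsum : Integrable (fun x : Ω =>
      ∑ y, (A y * (κ x).real {y} + inner ℝ ((κ x).real {y} • toVec x.1) (g y))) μ :=
    integrable_finsetSum _ hterm
  have hFint : Integrable F μ := by
    rw [funext hF]
    exact hφX.sub hsum
  have hF0 : 0 ≤ᵐ[μ] F := by
    filter_upwards [hfin] with x hx
    exact Finset.sum_nonneg fun y _ => mul_nonneg measureReal_nonneg
      (bregman_nonneg hφ hd (toVec_mem_finitePart x hx) (v y).2)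
  have hint : ∫ x, F x ∂μ = expectedLoss φ κ μ v := by
    rw [funext hF, integral_sub hφX hsum, integral_finsetSum _ hterm]
    rw [expectedLoss]
    congr 1
    refine Finset.sum_congr rfl fun y _ => ?_
    rw [integral_add (hterm1 y) (hterm2 y), integral_const_mul]
    congr 1
    simp_rw [real_inner_comm (g y)]
    rw [integral_inner (integrable_kernel_smul hX y)]
    exact real_inner_comm _ _
  rw [← hint]
  refine ⟨integral_nonneg_of_ae hF0, ?_⟩
  rw [ofReal_integral_eq_lintegral_ofReal hFint hF0]
  refine lintegral_congr_ae ?_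
  filter_upwards [hfin] with x hx
  exact lintegral_loss_of_isFinitePoint hφ hd hx v

/-- Priors with the same conditional means have risks ordered as their means of `φ`. -/
theorem bregmanRisk_le_of_moments (hφ : ConvexOn ℝ (finitePart Ω) φ)
    (hd : DifferentiableOn ℝ φ (finitePart Ω)) {P Q : ProbabilityMeasure Ω}
    (hP : HasFiniteMean P) (hPφ : Integrable (fun x : Ω => φ (toVec x.1)) (P : Measure Ω))
    (hQ : HasFiniteMean Q) (hQφ : Integrable (fun x : Ω => φ (toVec x.1)) (Q : Measure Ω))
    (hκ : ∀ y, ∫ x, (κ x).real {y} ∂(Q : Measure Ω) = ∫ x, (κ x).real {y} ∂(P : Measure Ω))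
    (hκX : ∀ y, ∫ x, (κ x).real {y} • toVec x.1 ∂(Q : Measure Ω) =
      ∫ x, (κ x).real {y} • toVec x.1 ∂(P : Measure Ω))
    (hle : ∫ x, φ (toVec x.1) ∂(P : Measure Ω) ≤ ∫ x, φ (toVec x.1) ∂(Q : Measure Ω)) :
    bregmanRisk φ κ P ≤ bregmanRisk φ κ Q := by
  refine iInf_mono fun v => ?_
  rw [(lintegral_lintegral_loss hφ hd hP.1 hP.2 hPφ v.1).2,
    (lintegral_lintegral_loss hφ hd hQ.1 hQ.2 hQφ v.1).2]
  refine ENNReal.ofReal_le_ofReal ?_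
  rw [expectedLoss, expectedLoss]
  simp_rw [hκ, hκX]
  linarith

variable {k : ℕ} {f : Fin k → Ω → EReal} {c : Fin k → ℝ}

/-- Upper semicontinuity along mixtures: estimates with finite conditional expected loss under `P`
come arbitrarily close to the conditional mean under `Q`. -/
theorem exists_estimate_near_mean (hφ : ConvexOn ℝ (finitePart Ω) φ)
    (hd : DifferentiableOn ℝ φ (finitePart Ω))
    (husc : UpperSemicontinuousOn (bregmanRisk φ κ) (momentSet f c))
    {P Q : ProbabilityMeasure Ω} (hP : P ∈ momentSet f c) (hQ : Q ∈ momentSet f c)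
    (hRQ : bregmanRisk φ κ Q < ⊤) (hQm : HasFiniteMean Q)
    (hQφ : Integrable (fun x : Ω => φ (toVec x.1)) (Q : Measure Ω)) (y : 𝒴)
    (hq : 0 < ∫ x, (κ x).real {y} ∂(Q : Measure Ω)) (m : finitePart Ω)
    (hm : ∫ x, (κ x).real {y} • toVec x.1 ∂(Q : Measure Ω) =
      (∫ x, (κ x).real {y} ∂(Q : Measure Ω)) • m.1) {δ : ℝ} (hδ : 0 < δ) :
    ∃ v ∈ finitePart Ω, ∫⁻ x, loss Ω φ x.1 v * κ x {y} ∂(P : Measure Ω) < ⊤ ∧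
      bregman (finitePart Ω) φ m.1 v ≤ δ := by
  classical
  set q := ∫ x, (κ x).real {y} ∂(Q : Measure Ω) with hqdef
  set r := (bregmanRisk φ κ Q).toReal with hr
  -- Replacing `v y` by `m` gains `q` times the divergence, while the loss under `Q` is less than `2
  -- * ε = q * δ` above the risk `r`: one `ε` for the mixture, one for its weight `j / (j + 1)`.
  set ε := δ * q / 2 with hε
  have hε0 : 0 < ε := by positivity
  have hr0 : 0 ≤ r := ENNReal.toReal_nonneg
  have hRlt : bregmanRisk φ κ Q < ENNReal.ofReal (r + ε) := by
    rw [← ENNReal.ofReal_toReal hRQ.ne]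
    exact (ENNReal.ofReal_lt_ofReal_iff (by positivity)).2 (by linarith)
  have hlim : Filter.Tendsto (fun j : ℕ => (j / (j + 1) : ℝ) * (r + 2 * ε)) Filter.atTop
      (𝓝 (1 * (r + 2 * ε))) :=
    (tendsto_natCast_div_add_atTop (1 : ℝ)).mul_const _
  have hev := hlim.eventually_const_lt (u := r + ε) (by linarith)
  obtain ⟨j, hj1, hj2, hj3⟩ := ((exists_mixture_bregmanRisk_lt husc hQ hP hRlt).and
    (hev.and (Filter.eventually_gt_atTop 0))).exists
  have hj0 : 0 < (j / (j + 1) : ℝ) := by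
    have : (0 : ℝ) < j := by exact_mod_cast hj3
    positivity
  rw [bregmanRisk, iInf_lt_iff] at hj1
  obtain ⟨⟨v, hv⟩, hvlt⟩ := hj1
  rw [lintegral_mixture] at hvlt
  obtain ⟨hnn, heq⟩ := lintegral_lintegral_loss (κ := κ) hφ hd hQm.1 hQm.2 hQφ v
  obtain ⟨hnn', heq'⟩ := lintegral_lintegral_loss (κ := κ) hφ hd hQm.1 hQm.2 hQφ
    (Function.update v y m)
  refine ⟨(v y).1, (v y).2, ?_, ?_⟩
  · have h1 := (ENNReal.add_lt_top.1 (hvlt.trans ENNReal.ofReal_lt_top)).2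
    have h2 : ∫⁻ x, ∫⁻ y, loss Ω φ x.1 (v y).1 ∂(κ x) ∂(P : Measure Ω) < ⊤ := by
      refine lt_top_iff_ne_top.2 fun h => ?_
      rw [h, ENNReal.mul_top (by simp)] at h1
      exact lt_irrefl _ h1
    refine lt_of_le_of_lt (lintegral_mono fun x => ?_) h2
    rw [lintegral_loss]
    exact Finset.single_le_sum (f := fun y => loss Ω φ x.1 (v y).1 * κ x {y})
      (fun _ _ => zero_le) (Finset.mem_univ y)
  · have hsub := expectedLoss_sub_update (φ := φ) (κ := κ) v y m hm
    have h1 : r ≤ expectedLoss φ κ Q (Function.update v y m) := by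
      have h2 : bregmanRisk φ κ Q ≤
          ENNReal.ofReal (expectedLoss φ κ Q (Function.update v y m)) := by
        rw [← heq']
        exact iInf_le (fun v : {v : 𝒴 → finitePart Ω // Measurable v} =>
          ∫⁻ x, ∫⁻ y, loss Ω φ x.1 (v.1 y).1 ∂(κ x) ∂(Q : Measure Ω))
          ⟨Function.update v y m, .of_discrete⟩
      exact ENNReal.toReal_le_of_le_ofReal hnn' h2
    have h3 : (j / (j + 1) : ℝ) * expectedLoss φ κ Q v < r + ε := by
      have h4 := lt_of_le_of_lt le_self_add hvlt
      rw [heq] at h4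
      have h5 : (((j / (j + 1) : ℝ≥0) : ℝ≥0∞)) = ENNReal.ofReal (j / (j + 1) : ℝ) := by
        rw [ENNReal.ofReal, ENNReal.coe_inj]
        ext
        rw [Real.coe_toNNReal _ hj0.le]
        simp
      rw [h5, ← ENNReal.ofReal_mul hj0.le] at h4
      exact (ENNReal.ofReal_lt_ofReal_iff (by positivity)).1 h4
    have h6 : expectedLoss φ κ Q v < r + 2 * ε := by
      have := h3.trans hj2
      exact lt_of_mul_lt_mul_left this hj0.le
    have h7 : q * bregman (finitePart Ω) φ m.1 (v y).1 ≤ q * δ := by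
      rw [← hsub]
      have : q * δ = 2 * ε := by rw [hε]; ring
      linarith
    exact le_of_mul_le_mul_left h7 hq

end Risk

/-! ### Finite risk implies integrability -/

section Integrability

variable {n k : ℕ} {Ω : Set (Fin n → EReal)} {φ : EuclideanSpace ℝ (Fin n) → ℝ}
  {𝒴 : Type*} [MeasurableSpace 𝒴] {κ : Kernel Ω 𝒴} [IsMarkovKernel κ]
  {f : Fin k → Ω → EReal} {c : Fin k → ℝ}

theorem ae_isFinitePoint_of_bregmanRisk_lt_top {P : ProbabilityMeasure Ω}
    (hP : bregmanRisk φ κ P < ⊤) : ∀ᵐ x ∂(P : Measure Ω), IsFinitePoint x.1 := by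
  rw [bregmanRisk, iInf_lt_iff] at hP
  obtain ⟨v, hv⟩ := hP
  by_contra h
  rw [ae_iff] at h
  have hset : MeasurableSet {x : Ω | ¬ IsFinitePoint x.1} := measurableSet_isFinitePoint.compl
  refine hv.ne (top_le_iff.1 ?_)
  calc (⊤ : ℝ≥0∞) = ∫⁻ x, {x : Ω | ¬ IsFinitePoint x.1}.indicator (fun _ => ⊤) x
        ∂(P : Measure Ω) := by
        rw [lintegral_indicator_const hset, ENNReal.top_mul h]
    _ ≤ _ := by
        refine lintegral_mono fun x => ?_
        by_cases hx : IsFinitePoint x.1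
        · simp [hx]
        · simp [loss, hx]

variable [MeasurableSingletonClass 𝒴]

theorem integrable_kernel_mul_bregman (hφ : ConvexOn ℝ (finitePart Ω) φ)
    (hd : DifferentiableOn ℝ φ (finitePart Ω)) {μ : Measure Ω}
    (hμ : ∀ᵐ x ∂μ, IsFinitePoint x.1) {y : 𝒴} {v : EuclideanSpace ℝ (Fin n)}
    (hv : v ∈ finitePart Ω) (hlt : ∫⁻ x, loss Ω φ x.1 v * κ x {y} ∂μ < ⊤) :
    Integrable (fun x => (κ x).real {y} * bregman (finitePart Ω) φ (toVec x.1) v) μ := by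
  refine ⟨?_, ?_⟩
  · have h1 := aemeasurable_comp_toVec hd.continuousOn hμ
    have h2 : Measurable fun x : Ω =>
        inner ℝ (toVec x.1) (gradientWithin φ (finitePart Ω) v) :=
      measurable_toVec.inner_const
    simp_rw [bregman_eq]
    exact ((measurable_kernel_real κ y).aemeasurable.mul
      (h1.sub (h2.const_add _).aemeasurable)).aestronglyMeasurable
  · refine lt_of_le_of_lt (le_of_eq ?_) hlt
    refine lintegral_congr_ae ?_
    filter_upwards [hμ] with x hx
    have h0 := bregman_nonneg hφ hd (toVec_mem_finitePart x hx) hv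
    rw [loss_of_isFinitePoint hx, Real.enorm_of_nonneg (mul_nonneg measureReal_nonneg h0),
      ENNReal.ofReal_mul measureReal_nonneg, ofReal_measureReal, mul_comm]

/-- There is a discrete prior in the moment set with prescribed atoms from a suitable set of full
measure. -/
theorem exists_discrete_prior_with_atoms {P : ProbabilityMeasure Ω} (hP : P ∈ momentSet f c)
    {S : Set Ω} (hS : ∀ᵐ x ∂(P : Measure Ω), x ∈ S) :
    ∃ S' ⊆ S, (∀ᵐ x ∂(P : Measure Ω), x ∈ S') ∧ ∀ B : Finset Ω, B.Nonempty → (B : Set Ω) ⊆ S' →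
      ∃ (w : Ω →₀ ℝ≥0) (hw : (w.sum fun _ a => a) = 1), (w.support : Set Ω) ⊆ S' ∧
        B ⊆ w.support ∧ discreteProb w hw ∈ momentSet f c := by
  classical
  have hfin : ∀ᵐ x ∂(P : Measure Ω), x ∈ {x : Ω | x ∈ S ∧ ∀ i, f i x ≠ ⊥ ∧ f i x ≠ ⊤} := by
    filter_upwards [hS, ae_all_iff.2 fun i => (hP.2 i).1] with x h1 h2
    exact ⟨h1, h2⟩
  let M : Fin k → ℝ := fun i => ∫ x, (f i x).toReal ∂(P : Measure Ω)
  have hgi : ∀ i, Integrable (fun x => (f i x).toReal - M i) (P : Measure Ω) := fun i =>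
    (hP.2 i).2.1.sub (integrable_const _)
  have hg0 : ∫ x, (fun i => (f i x).toReal - M i) ∂(P : Measure Ω) = 0 := by
    ext i
    rw [eval_integral hgi, integral_sub (hP.2 i).2.1 (integrable_const _)]
    simp [M]
  obtain ⟨S', hS'S, hS', hw⟩ := exists_weights_of_integral_eq_zero (P : Measure Ω)
    (Integrable.of_eval hgi) hg0 hfin
  refine ⟨S', fun x hx => (hS'S hx).1, hS', fun B hB hBS => ?_⟩
  choose! W hWS hWx hW1 hW0 using hw
  -- Each `W b` charges `b` and satisfies the linear constraints, so their average charges all of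
  -- `B` and still satisfies them.
  let w : Ω →₀ ℝ≥0 := ∑ b ∈ B, (B.card : ℝ≥0)⁻¹ • W b
  have hcard : (B.card : ℝ≥0) ≠ 0 := by exact_mod_cast hB.card_pos.ne'
  have hwx : ∀ x, w x = ∑ b ∈ B, (B.card : ℝ≥0)⁻¹ * W b x := fun x => by
    simp [w]
  have hlc : ∀ v : Ω →₀ ℝ≥0, Finsupp.linearCombination ℝ≥0 (fun _ => (1 : ℝ≥0)) v =
      v.sum fun _ a => a := fun v => by
    simp [Finsupp.linearCombination_apply]
  have hw1 : (w.sum fun _ a => a) = 1 := by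
    rw [← hlc, map_sum]
    simp_rw [map_smul, hlc]
    rw [Finset.sum_congr rfl fun b hb => by rw [hW1 b (hBS hb)]]
    simp [hcard]
  have hw0 : Finsupp.linearCombination ℝ≥0 (fun x i => (f i x).toReal - M i) w = 0 := by
    rw [map_sum]
    refine Finset.sum_eq_zero fun b hb => ?_
    rw [map_smul, hW0 b (hBS hb), smul_zero]
  have hwS : (w.support : Set Ω) ⊆ S' := by
    intro x hx
    have hx' : w x ≠ 0 := by simpa using hx
    rw [hwx] at hx'
    obtain ⟨b, hb, hbx⟩ := Finset.exists_ne_zero_of_sum_ne_zero hx'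
    exact hWS b (hBS hb) (by simpa using right_ne_zero_of_mul hbx)
  refine ⟨w, hw1, hwS, fun b hb => ?_, discreteProb_mem_momentSet hw1
    (fun i x hx => (hS'S (hwS hx)).2 i) fun i => ?_⟩
  · rw [Finsupp.mem_support_iff, hwx]
    refine (lt_of_lt_of_le ?_ (Finset.single_le_sum (f := fun b' => (B.card : ℝ≥0)⁻¹ * W b' b)
      (fun _ _ => zero_le) hb)).ne'
    have := hWx b (hBS hb)
    positivity
  · rw [sum_mul_eq_of_linearCombination_sub_eq_zero hw1 hw0 i]
    exact (hP.2 i).2.2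

variable [Fintype 𝒴]

/-- A finite risk at every point of the moment set makes `X` and `φ X` integrable, conditionally on
`Y = y`. -/
theorem integrable_of_bregmanRisk_lt_top_of_fiber (hφ : StrictConvexOn ℝ (finitePart Ω) φ)
    (hd : DifferentiableOn ℝ φ (finitePart Ω))
    (husc : UpperSemicontinuousOn (bregmanRisk φ κ) (momentSet f c))
    {P : ProbabilityMeasure Ω} (hP : P ∈ momentSet f c) (hR : bregmanRisk φ κ P < ⊤) (y : 𝒴) :
    Integrable (fun x => (κ x).real {y} • toVec x.1) (P : Measure Ω) ∧
      Integrable (fun x => (κ x).real {y} • φ (toVec x.1)) (P : Measure Ω) := by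
  classical
  have hfin := ae_isFinitePoint_of_bregmanRisk_lt_top hR
  obtain ⟨S', hS'S, hS', hatoms⟩ := exists_discrete_prior_with_atoms hP
    (S := {x : Ω | IsFinitePoint x.1}) hfin
  set Sy : Set Ω := {x ∈ S' | (κ x).real {y} ≠ 0} with hSy
  rcases Sy.eq_empty_or_nonempty with hempty | ⟨x₀, hx₀⟩
  · have h0 : ∀ᵐ x ∂(P : Measure Ω), (κ x).real {y} = 0 := by
      filter_upwards [hS'] with x hx
      by_contra h
      have : x ∈ Sy := ⟨hx, h⟩
      rw [hempty] at this
      exact this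
    constructor
    · refine (integrable_zero Ω _ _).congr ?_
      filter_upwards [h0] with x hx
      simp [hx]
    · refine (integrable_zero Ω _ _).congr ?_
      filter_upwards [h0] with x hx
      simp [hx]
  -- The coordinate `1` turns affine spans into linear ones: finitely many atoms `B₀` affinely
  -- generate all finite points of `Sy`. Adding `x₀` ensures that `Y = y` has positive probability
  -- under `Q`.
  let lift : Ω → ℝ × EuclideanSpace ℝ (Fin n) := fun x => (1, toVec x.1)
  obtain ⟨B', hB'S, hspan⟩ := (Submodule.fg_span_iff_fg_span_finset_subset (lift '' Sy)).1
    (IsNoetherian.noetherian (R := ℝ) (Submodule.span ℝ (lift '' Sy)))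
  obtain ⟨B₀, hB₀, rfl⟩ := Finset.subset_set_image_iff.1 hB'S
  set B := insert x₀ B₀ with hB
  have hBSy : (B : Set Ω) ⊆ Sy := by
    rw [hB, Finset.coe_insert]
    exact Set.insert_subset hx₀ hB₀
  obtain ⟨w, hw1, hwS, hBw, hQ⟩ := hatoms B (Finset.insert_nonempty _ _) fun x hx => (hBSy hx).1
  set Q := discreteProb w hw1 with hQdef
  have hRQ := bregmanRisk_lt_top_of_lt_top husc hP hQ hR
  have hQm : HasFiniteMean Q := ⟨ae_discreteMeasure fun x hx => hS'S (hwS hx),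
    integrable_discreteMeasure _ _⟩
  have hQφ : Integrable (fun x : Ω => φ (toVec x.1)) (Q : Measure Ω) :=
    integrable_discreteMeasure _ _
  set q := ∫ x, (κ x).real {y} ∂(Q : Measure Ω) with hq
  set A := w.support.filter fun x => (κ x).real {y} ≠ 0 with hA
  have hqA : q = ∑ x : A, (w x : ℝ) * (κ x.1).real {y} := by
    rw [hq, hQdef, coe_discreteProb, integral_discreteMeasure, Finsupp.sum,
      Finset.sum_coe_sort A fun x => (w x : ℝ) * (κ x).real {y}, hA, Finset.sum_filter_of_ne]
    · rfl
    · intro x _ hx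
      exact right_ne_zero_of_mul hx
  have hpos : ∀ x : A, 0 < (w x : ℝ) * (κ x.1).real {y} := by
    intro x
    have hx := Finset.mem_filter.1 x.2
    have h1 : 0 < w x := pos_iff_ne_zero.2 (by simpa using hx.1)
    have h2 : 0 < (κ x.1).real {y} := lt_of_le_of_ne measureReal_nonneg hx.2.symm
    positivity
  have hBA : ∀ b ∈ B, b ∈ A := fun b hb => Finset.mem_filter.2 ⟨hBw hb, (hBSy hb).2⟩
  have hq0 : 0 < q := by
    rw [hqA]
    exact Finset.sum_pos (fun x _ => hpos x)
      ⟨⟨x₀, hBA x₀ (Finset.mem_insert_self _ _)⟩, Finset.mem_univ _⟩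
  -- The conditional law of `X` given `Y = y` under `Q`; its mean is `m`.
  let p : A → ℝ := fun x => (w x : ℝ) * (κ x.1).real {y} / q
  have hp0 : ∀ x, 0 < p x := fun x => div_pos (hpos x) hq0
  have hp1 : ∑ x, p x = 1 := by
    rw [← Finset.sum_div, ← hqA, div_self hq0.ne']
  have hAD : ∀ x : A, toVec x.1.1 ∈ finitePart Ω := fun x =>
    toVec_mem_finitePart _ (hS'S (hwS (Finset.mem_filter.1 x.2).1))
  set m : EuclideanSpace ℝ (Fin n) := ∑ x, p x • toVec x.1.1 with hm
  have hmD : m ∈ finitePart Ω :=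
    hφ.1.sum_mem (fun x _ => (hp0 x).le) hp1 fun x _ => hAD x
  have hmean : ∫ x, (κ x).real {y} • toVec x.1 ∂(Q : Measure Ω) = q • m := by
    rw [hm, Finset.smul_sum, hQdef, coe_discreteProb, integral_discreteMeasure, Finsupp.sum]
    have h1 : ∀ x : A, q • p x • toVec x.1.1 =
        (w x : ℝ) • (κ x.1).real {y} • toVec x.1.1 := fun x => by
      rw [smul_smul, smul_smul, mul_div_cancel₀ _ hq0.ne']
    simp_rw [h1]
    rw [Finset.sum_coe_sort A fun x => (w x : ℝ) • (κ x).real {y} • toVec x.1, hA,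
      Finset.sum_filter_of_ne]
    intro x _ hx h0
    simp [h0] at hx
  obtain ⟨r, hr, hball⟩ := exists_ball_subset_of_convex_combination hφ.1
    (fun x : A => toVec x.1.1) hAD p hp0 hp1 hm
  set V := Submodule.span ℝ (Set.range fun x : A => toVec x.1.1 - m) with hV
  have hSV : ∀ x ∈ Sy, toVec x.1 - m ∈ V := by
    intro x hx
    let Λ : ℝ × EuclideanSpace ℝ (Fin n) →ₗ[ℝ] EuclideanSpace ℝ (Fin n) :=
      LinearMap.snd ℝ _ _ - (LinearMap.fst ℝ _ _).smulRight m
    have hΛ : ∀ x, Λ (lift x) = toVec x.1 - m := fun x => by simp [Λ, lift]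
    have h1 : lift x ∈ Submodule.span ℝ (lift '' Sy) :=
      Submodule.subset_span (Set.mem_image_of_mem _ hx)
    rw [hspan] at h1
    have h2 : Submodule.span ℝ ((B₀.image lift : Finset _) : Set _) ≤ V.comap Λ := by
      rw [Submodule.span_le]
      intro z hz
      obtain ⟨b, hb, rfl⟩ := Finset.mem_image.1 hz
      rw [SetLike.mem_coe, Submodule.mem_comap, hΛ]
      exact Submodule.subset_span ⟨⟨b, hBA b (Finset.mem_insert_of_mem hb)⟩, rfl⟩
    rw [← hΛ]
    exact h2 h1
  obtain ⟨δ, hδ, C, hgrowth⟩ := exists_growth_of_strictConvexOn hφ hd.continuousOn hr hball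
  obtain ⟨v, hv, hvlt, hvδ⟩ := exists_estimate_near_mean hφ.convexOn hd husc hP hQ hRQ hQm hQφ y
    hq0 ⟨m, hmD⟩ hmean hδ
  have hH := integrable_kernel_mul_bregman hφ.convexOn hd hfin hv hvlt
  set g := gradientWithin φ (finitePart Ω) v with hg
  -- The growth estimate is applied to the tangent of `φ` at `v`, whose distance below `φ` is the
  -- divergence from `v`.
  have hbd : ∀ x ∈ Sy, ‖toVec x.1 - m‖ ≤ r + C * bregman (finitePart Ω) φ (toVec x.1) v := by
    intro x hx
    have hL : ∀ u, φ u - (φ v - inner ℝ v g + (innerSL ℝ g).toLinearMap u) =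
        bregman (finitePart Ω) φ u v := fun u => by
      rw [bregman_eq, ← hg, real_inner_comm g u]
      rfl
    have h1 := hgrowth (φ v - inner ℝ v g) (innerSL ℝ g).toLinearMap
      (fun u hu => sub_nonneg.1 ((hL u).symm ▸ bregman_nonneg hφ.convexOn hd hu hv))
      (by linarith [hL m]) (toVec x.1) (toVec_mem_finitePart x (hS'S hx.1)) (hSV x hx)
    rwa [hL] at h1
  have hκi := integrable_kernel_real κ (P : Measure Ω) y
  have hsub : Integrable (fun x => (κ x).real {y} • (toVec x.1 - m)) (P : Measure Ω) := by
    refine Integrable.mono' ((hκi.mul_const r).add (hH.const_mul C)) ?_ ?_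
    · exact ((measurable_kernel_real κ y).smul
        (measurable_toVec.sub_const m)).aestronglyMeasurable
    · filter_upwards [hS'] with x hx
      rw [norm_smul, Real.norm_of_nonneg measureReal_nonneg]
      by_cases h0 : (κ x).real {y} = 0
      · simp [h0]
      · have h1 := mul_le_mul_of_nonneg_left (hbd x ⟨hx, h0⟩)
          (measureReal_nonneg (μ := κ x) (s := {y}))
        refine h1.trans (le_of_eq ?_)
        simp only [Pi.add_apply]
        ring
  have hX : Integrable (fun x => (κ x).real {y} • toVec x.1) (P : Measure Ω) := by
    refine (hsub.add (hκi.smul_const m)).congr (Filter.Eventually.of_forall fun x => ?_)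
    simp [smul_sub]
  refine ⟨hX, ?_⟩
  -- `φ` is the divergence from `v` plus an affine function, and both are integrable against the
  -- kernel weight.
  refine ((hH.add (hκi.mul_const (φ v - inner ℝ v g))).add (hX.inner_const g)).congr
    (Filter.Eventually.of_forall fun x => ?_)
  simp only [Pi.add_apply, bregman_eq, smul_eq_mul, real_inner_smul_left, ← hg]
  ring

theorem integrable_of_bregmanRisk_lt_top (hφ : StrictConvexOn ℝ (finitePart Ω) φ)
    (hd : DifferentiableOn ℝ φ (finitePart Ω))
    (husc : UpperSemicontinuousOn (bregmanRisk φ κ) (momentSet f c))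
    {P : ProbabilityMeasure Ω} (hP : P ∈ momentSet f c) (hR : bregmanRisk φ κ P < ⊤) :
    HasFiniteMean P ∧ Integrable (fun x : Ω => φ (toVec x.1)) (P : Measure Ω) := by
  have h := integrable_of_bregmanRisk_lt_top_of_fiber hφ hd husc hP hR
  refine ⟨⟨ae_isFinitePoint_of_bregmanRisk_lt_top hR, ?_⟩, ?_⟩
  · refine (integrable_finsetSum Finset.univ fun y _ => (h y).1).congr
      (Filter.Eventually.of_forall fun x => ?_)
    simp only [← Finset.sum_smul, sum_kernel_real, one_smul]
  · refine (integrable_finsetSum Finset.univ fun y _ => (h y).2).congr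
      (Filter.Eventually.of_forall fun x => ?_)
    simp only [← Finset.sum_smul, sum_kernel_real, one_smul]

end Integrability

/-! ### Discrete maximizers and T-compatibility -/

section Main

variable {n k : ℕ} {Ω : Set (Fin n → EReal)}
  {𝒴 : Type*} [MeasurableSpace 𝒴] [MeasurableSingletonClass 𝒴]
  {κ : Kernel Ω 𝒴} [IsMarkovKernel κ] {f : Fin k → Ω → EReal} {c : Fin k → ℝ}

theorem setIntegral_compProd_singleton {E : Type*} [NormedAddCommGroup E] [NormedSpace ℝ E]
    [CompleteSpace E] {P : ProbabilityMeasure Ω} {g : Ω → E}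
    (hg : Integrable (fun z : Ω × 𝒴 => g z.1) ((P : Measure Ω) ⊗ₘ κ)) (y : 𝒴) :
    ∫ z in Prod.snd ⁻¹' {y}, g z.1 ∂((P : Measure Ω) ⊗ₘ κ) =
      ∫ x, (κ x).real {y} • g x ∂(P : Measure Ω) := by
  rw [← Set.univ_prod, Measure.setIntegral_compProd MeasurableSet.univ
    (measurableSet_singleton y) hg.integrableOn, Measure.restrict_univ]
  simp [Measure.real]

/-- The conditional expectation is tested on the event `Y = y`, where `T` is constant. -/
theorem integral_kernel_smul_toVec_of_condExp {P : ProbabilityMeasure Ω} (hP : HasFiniteMean P)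
    {T : 𝒴 → EuclideanSpace ℝ (Fin n)}
    (hT : ((P : Measure Ω) ⊗ₘ κ)[fun z : Ω × 𝒴 => toVec z.1.1 |
        MeasurableSpace.comap (Prod.snd : Ω × 𝒴 → 𝒴) inferInstance]
      =ᵐ[(P : Measure Ω) ⊗ₘ κ] fun z => T z.2) (y : 𝒴) :
    ∫ x, (κ x).real {y} • toVec x.1 ∂(P : Measure Ω) =
      (∫ x, (κ x).real {y} ∂(P : Measure Ω)) • T y := by
  have hint : Integrable (fun z : Ω × 𝒴 => toVec z.1.1) ((P : Measure Ω) ⊗ₘ κ) := by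
    have h := hP.2
    rw [← Measure.fst_compProd (P : Measure Ω) κ, Measure.fst] at h
    exact h.comp_measurable measurable_fst
  have hm : MeasurableSpace.comap (Prod.snd : Ω × 𝒴 → 𝒴) inferInstance ≤
      (inferInstance : MeasurableSpace (Ω × 𝒴)) := measurable_snd.comap_le
  have hs : MeasurableSet[MeasurableSpace.comap (Prod.snd : Ω × 𝒴 → 𝒴) inferInstance]
      (Prod.snd ⁻¹' {y} : Set (Ω × 𝒴)) := ⟨{y}, measurableSet_singleton y, rfl⟩
  rw [← setIntegral_compProd_singleton hint y, ← setIntegral_condExp hm hint hs,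
    setIntegral_congr_ae (g := fun _ => T y) (hm _ hs) (by
      filter_upwards [hT] with z hz hzy
      rw [hz, hzy]),
    setIntegral_compProd_singleton (g := fun _ => T y) (integrable_const _) y,
    integral_smul_const]

variable [Fintype 𝒴]

/-- A prior in the moment set can be replaced by a discrete one, keeping the marginal of `Y` and
finitely many further moments, without decreasing the mean of `ψ`. -/
theorem exists_discrete_prior {P : ProbabilityMeasure Ω} (hP : P ∈ momentSet f c)
    {S : Set Ω} (hS : ∀ᵐ x ∂(P : Measure Ω), x ∈ S) {J : Type*} [Fintype J] {g : J → Ω → ℝ}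
    (hg : ∀ j, Integrable (g j) (P : Measure Ω)) {ψ : Ω → ℝ}
    (hψ : Integrable ψ (P : Measure Ω)) :
    ∃ (w : Ω →₀ ℝ≥0) (hw : (w.sum fun _ a => a) = 1), (w.support : Set Ω) ⊆ S ∧
      w.support.card ≤ Fintype.card 𝒴 + k + Fintype.card J ∧ discreteProb w hw ∈ momentSet f c ∧
      (∀ y, ∫ x, (κ x).real {y} ∂(discreteProb w hw : Measure Ω) =
        ∫ x, (κ x).real {y} ∂(P : Measure Ω)) ∧
      (∀ j, ∫ x, g j x ∂(discreteProb w hw : Measure Ω) = ∫ x, g j x ∂(P : Measure Ω)) ∧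
      ∫ x, ψ x ∂(P : Measure Ω) ≤ ∫ x, ψ x ∂(discreteProb w hw : Measure Ω) := by
  have hfin : ∀ᵐ x ∂(P : Measure Ω), x ∈ {x : Ω | x ∈ S ∧ ∀ i, f i x ≠ ⊥ ∧ f i x ≠ ⊤} := by
    filter_upwards [hS, ae_all_iff.2 fun i => (hP.2 i).1] with x h1 h2
    exact ⟨h1, h2⟩
  let G : Ω → (𝒴 ⊕ Fin k) ⊕ J → ℝ := fun x =>
    Sum.elim (Sum.elim (fun y => (κ x).real {y}) fun i => (f i x).toReal) fun j => g j x
  -- The constraints for `Y` alone sum to `1`, so total mass one costs no further atom.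
  obtain ⟨w, hwS, hwc, hwG, hwψ⟩ := exists_weights_moments (P : Measure Ω) hfin G
    (by
      rintro ((y | i) | j)
      · exact integrable_kernel_real κ _ y
      · exact (hP.2 i).2.1
      · exact hg j) ψ hψ (Sum.elim (Sum.elim 1 0) 0) (fun x => by
        simp [G, Fintype.sum_sum_type])
  have hsum : ∑ x ∈ w.support, (w x : ℝ) = 1 := by
    calc ∑ x ∈ w.support, (w x : ℝ) = ∑ x ∈ w.support, (w x : ℝ) * ∑ y, (κ x).real {y} := by
          simp
      _ = ∑ y, w.sum fun x a => (a : ℝ) * (κ x).real {y} := by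
          simp_rw [Finset.mul_sum]
          exact Finset.sum_comm
      _ = ∑ y, ∫ x, (κ x).real {y} ∂(P : Measure Ω) :=
          Finset.sum_congr rfl fun y _ => hwG (Sum.inl (Sum.inl y))
      _ = 1 := by
          rw [← integral_finsetSum _ fun y _ => integrable_kernel_real κ _ y]
          simp
  have hw : (w.sum fun _ a => a) = 1 := by
    rw [Finsupp.sum]
    exact_mod_cast hsum
  refine ⟨w, hw, fun x hx => (hwS hx).1, by simpa using hwc, discreteProb_mem_momentSet hw
    (fun i x hx => (hwS hx).2 i) fun i => ?_, fun y => ?_, fun j => ?_, ?_⟩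
  · exact (hwG (Sum.inl (Sum.inr i))).trans_le (hP.2 i).2.2
  · rw [coe_discreteProb, integral_discreteMeasure]
    exact hwG (Sum.inl (Sum.inl y))
  · rw [coe_discreteProb, integral_discreteMeasure]
    exact hwG (Sum.inr j)
  · rw [coe_discreteProb, integral_discreteMeasure]
    exact hwψ

theorem comp_eq_of_integral_eq {P Q : ProbabilityMeasure Ω}
    (h : ∀ y, ∫ x, (κ x).real {y} ∂(Q : Measure Ω) = ∫ x, (κ x).real {y} ∂(P : Measure Ω)) :
    κ ∘ₘ (Q : Measure Ω) = κ ∘ₘ (P : Measure Ω) := by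
  have key : ∀ (R : ProbabilityMeasure Ω) (y : 𝒴), (κ ∘ₘ (R : Measure Ω)) {y} =
      ENNReal.ofReal (∫ x, (κ x).real {y} ∂(R : Measure Ω)) := by
    intro R y
    rw [Measure.bind_apply (measurableSet_singleton y) κ.aemeasurable,
      ofReal_integral_eq_lintegral_ofReal (integrable_kernel_real κ _ y)
        (Filter.Eventually.of_forall fun _ => measureReal_nonneg)]
    simp
  refine Measure.ext_of_singleton fun y => ?_
  rw [key, key, h]

theorem integral_kernel_smul_toVec_eq_of_tCompatible (hT : TCompatible κ (momentSet f c))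
    {P Q : ProbabilityMeasure Ω} (hP : P ∈ momentSet f c) (hQ : Q ∈ momentSet f c)
    (hPm : HasFiniteMean P) (hQm : HasFiniteMean Q)
    (h : ∀ y, ∫ x, (κ x).real {y} ∂(Q : Measure Ω) = ∫ x, (κ x).real {y} ∂(P : Measure Ω))
    (y : 𝒴) :
    ∫ x, (κ x).real {y} • toVec x.1 ∂(Q : Measure Ω) =
      ∫ x, (κ x).real {y} • toVec x.1 ∂(P : Measure Ω) := by
  obtain ⟨T, hT⟩ := hT
  rw [integral_kernel_smul_toVec_of_condExp (T := fun y => T y (κ ∘ₘ (P : Measure Ω))) hPm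
      (hT P hP hPm),
    integral_kernel_smul_toVec_of_condExp (T := fun y => T y (κ ∘ₘ (Q : Measure Ω))) hQm
      (hT Q hQ hQm), h, comp_eq_of_integral_eq h]

/-- A maximizer of the risk can be replaced by a discrete one that keeps the marginal of `Y` and
finitely many further moments, provided that these moments determine the conditional means. -/
theorem exists_discrete_isMaxOn {φ : EuclideanSpace ℝ (Fin n) → ℝ}
    (hφ : ConvexOn ℝ (finitePart Ω) φ) (hd : DifferentiableOn ℝ φ (finitePart Ω))
    {P : ProbabilityMeasure Ω} (hP : P ∈ momentSet f c)
    (hmax : IsMaxOn (bregmanRisk φ κ) (momentSet f c) P) (hPm : HasFiniteMean P)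
    (hPφ : Integrable (fun x : Ω => φ (toVec x.1)) (P : Measure Ω))
    {J : Type*} [Fintype J] {g : J → Ω → ℝ} (hg : ∀ j, Integrable (g j) (P : Measure Ω))
    (hmean : ∀ Q ∈ momentSet f c, HasFiniteMean Q →
      (∀ y, ∫ x, (κ x).real {y} ∂(Q : Measure Ω) = ∫ x, (κ x).real {y} ∂(P : Measure Ω)) →
      (∀ j, ∫ x, g j x ∂(Q : Measure Ω) = ∫ x, g j x ∂(P : Measure Ω)) →
      ∀ y, ∫ x, (κ x).real {y} • toVec x.1 ∂(Q : Measure Ω) =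
        ∫ x, (κ x).real {y} • toVec x.1 ∂(P : Measure Ω)) :
    ∃ Q ∈ momentSet f c, IsMaxOn (bregmanRisk φ κ) (momentSet f c) Q ∧
      HasAtMostMassPoints Q (Fintype.card 𝒴 + k + Fintype.card J) := by
  obtain ⟨w, hw, hwS, hwc, hQ, hκQ, hgQ, hle⟩ := exists_discrete_prior (κ := κ) hP hPm.1 hg hPφ
  have hQm : HasFiniteMean (discreteProb w hw) :=
    ⟨ae_discreteMeasure fun x hx => hwS hx, integrable_discreteMeasure _ _⟩
  have hrisk := bregmanRisk_le_of_moments hφ hd hPm hPφ hQm (integrable_discreteMeasure _ _) hκQ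
    (hmean _ hQ hQm hκQ hgQ) hle
  exact ⟨_, hQ, fun R hR => (hmax hR).trans hrisk, hasAtMostMassPoints_discreteProb hw hwc⟩

theorem HasAtMostMassPoints.mono {P : ProbabilityMeasure Ω} {d e : ℕ}
    (h : HasAtMostMassPoints P d) (hde : d ≤ e) : HasAtMostMassPoints P e :=
  let ⟨S, hS, hS0⟩ := h
  ⟨S, hS.trans hde, hS0⟩

end Main

end BregmanPrior

theorem theorem2 (n k N : ℕ) (Ω : Set (Fin n → EReal))
    {𝒴 : Type*} [Finite 𝒴] [MeasurableSpace 𝒴] [MeasurableSingletonClass 𝒴]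
    (hN : Nat.card 𝒴 ≤ N)
    (φ : EuclideanSpace ℝ (Fin n) → ℝ)
    (hφ_diff : ContDiffOn ℝ 1 φ (finitePart Ω))
    (hφ_conv : StrictConvexOn ℝ (finitePart Ω) φ)
    (κ : Kernel Ω 𝒴) [IsMarkovKernel κ]
    (hκ : ∀ y : 𝒴, ContinuousOn (fun x : Ω => κ x {y}) {x : Ω | x.1 ∈ interior Ω})
    (f : Fin k → Ω → EReal) (hf : ∀ i, Measurable (f i)) (c : Fin k → ℝ)
    (hne : (momentSet f c).Nonempty)
    (hcompact : IsCompact (momentSet f c))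
    (husc : UpperSemicontinuousOn (bregmanRisk φ κ) (momentSet f c)) :
    ∃ P ∈ momentSet f c,
      IsMaxOn (bregmanRisk φ κ) (momentSet f c) P ∧
      HasAtMostMassPoints P (N * (k + 1) * (n + 1)) ∧
      (TCompatible κ (momentSet f c) → HasAtMostMassPoints P (N * (k + 1))) := by
  cases nonempty_fintype 𝒴
  have hd : DifferentiableOn ℝ φ (finitePart Ω) := hφ_diff.differentiableOn one_ne_zero
  obtain ⟨P, hP, hmax⟩ := husc.exists_isMaxOn hne hcompact
  rw [Nat.card_eq_fintype_card] at hN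
  -- A probability measure lives on `𝒴`, so `N ≥ 1`; this absorbs `k` into `N * k`.
  have hcard : 0 < Fintype.card 𝒴 := by
    obtain ⟨x⟩ := P.nonempty
    rw [Fintype.card_pos_iff]
    exact (κ x).nonempty_of_neZero
  have hle₁ : Fintype.card 𝒴 + k + Fintype.card Empty ≤ N * (k + 1) := by
    have : k ≤ N * k := Nat.le_mul_of_pos_left k (by omega)
    simp only [Fintype.card_empty]
    linarith
  have hle₂ : N * (k + 1) ≤ N * (k + 1) * (n + 1) := Nat.le_mul_of_pos_right _ n.succ_pos
  by_cases hR : bregmanRisk φ κ P < ⊤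
  · obtain ⟨hPm, hPφ⟩ := integrable_of_bregmanRisk_lt_top hφ_conv hd husc hP hR
    by_cases hT : TCompatible κ (momentSet f c)
    · obtain ⟨Q, hQ, hQmax, hQd⟩ := exists_discrete_isMaxOn hφ_conv.convexOn hd hP hmax hPm hPφ
        (J := Empty) (g := Empty.elim) (fun j => j.elim) fun Q hQ hQm h _ =>
          integral_kernel_smul_toVec_eq_of_tCompatible hT hP hQ hPm hQm h
      exact ⟨Q, hQ, hQmax, hQd.mono (hle₁.trans hle₂), fun _ => hQd.mono hle₁⟩
    · have hint : ∀ (R : ProbabilityMeasure Ω), HasFiniteMean R → ∀ y i,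
          Integrable (fun x : Ω => ((κ x).real {y} • toVec x.1) i) (R : Measure Ω) :=
        fun R hR y i => (integrable_kernel_smul hR.2 y).eval_piLp i
      obtain ⟨Q, hQ, hQmax, hQd⟩ := exists_discrete_isMaxOn hφ_conv.convexOn hd hP hmax hPm hPφ
        (J := 𝒴 × Fin n) (g := fun j x => ((κ x).real {j.1} • toVec x.1) j.2)
        (fun j => hint P hPm j.1 j.2) fun Q hQ hQm _ h y => by
          ext i
          rw [eval_integral_piLp fun i => hint Q hQm y i,
            eval_integral_piLp fun i => hint P hPm y i]
          exact h (y, i)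
      refine ⟨Q, hQ, hQmax, hQd.mono ?_, fun h => absurd h hT⟩
      have h1 : k ≤ N * k := Nat.le_mul_of_pos_left k (by omega)
      have h2 : Fintype.card 𝒴 * n ≤ N * n := Nat.mul_le_mul_right n hN
      simp only [Fintype.card_prod, Fintype.card_fin]
      nlinarith [Nat.zero_le (N * k * n)]
  · have hR' : bregmanRisk φ κ P = ⊤ := not_lt_top_iff.1 hR
    -- With infinite risk nothing need be preserved beyond membership in the moment set, so the
    -- objective is `0`.
    obtain ⟨w, hw, -, hwc, hQ, -⟩ := exists_discrete_prior (κ := κ) hP (S := Set.univ) (by simp)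
      (J := Empty) (g := Empty.elim) (fun j => j.elim) (integrable_zero Ω ℝ _)
    have hQR : bregmanRisk φ κ (discreteProb w hw) = ⊤ := by
      by_contra h
      exact hR (bregmanRisk_lt_top_of_lt_top husc hQ hP (lt_top_iff_ne_top.2 h))
    have hQd := hasAtMostMassPoints_discreteProb hw hwc
    exact ⟨_, hQ, fun R _ => by simp [hQR], hQd.mono (hle₁.trans hle₂), fun _ => hQd.mono hle₁⟩
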